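/- Let $\mathcal X\subset\mathbb R^d$ be finite and non-empty, let $k:\mathcal X\times\mathcal X\to\mathbb R$ be a stationary kernel with $k(x,x)=1$ for all $x$, and let $f\sim\mathcal{GP}(0,k)$ be a Gaussian process on $\mathcal X$ with mean zero and covariance $k$. Querying a point $x_t$ returns $y_t=f(x_t)+\epsilon_t$, where $\epsilon_1,\epsilon_2,\dots$ are i.i.d. $\mathcal N(0,\sigma^2)$ with $\sigma>0$, independent of $f$. For $t\ge 1$ let $\mu_{t-1}(x)=\mathbf k_{t-1}(x)^\top(\mathbf K+\sigma^2 I)^{-1}\mathbf y_{t-1}$ and $\sigma_{t-1}^2(x)=k(x,x)-\mathbf k_{t-1}(x)^\top(\mathbf K+\sigma^2 I)^{-1}\mathbf k_{t-1}(x)$ be the posterior mean and variance of $f(x)$ given $(x_i,y_i)_{i<t}$, where $\mathbf k_{t-1}(x)=(k(x,x_i))_{i<t}$, $\mathbf K=(k(x_i,x_j))_{i,j<t}$ and $\mathbf y_{t-1}=(y_i)_{i<t}$. The algorithm IRGP-UCB chooses $$x_t\in\operatorname*{arg\,max}_{x\in\mathcal X}\ \mu_{t-1}(x)+\zeta_t^{1/2}\sigma_{t-1}(x),\qquad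 t=1,2,\dots,$$ where $\zeta_t=s+Z_t$ with $s=2\log(|\mathcal X|/2)$ and $Z_1,Z_2,\dots$ i.i.d. exponential with rate $1/2$, independent of $f$ and $(\epsilon_t)_t$. Ties are broken using only the history $(x_i,y_i)_{i<t}$, $(\zeta_i)_{i\le t}$ and possibly extra randomness independent of $f$, $(\epsilon_t)_t$ and $(\zeta_t)_t$. (If $|\mathcal X|=1$, then $\zeta_t^{1/2}$ may be undefined; it is then read as $0$, and the choice of $x_t$ is trivial.) Let $x^*\in\operatorname{arg\,max}_{x\in\mathcal X}f(x)$ and let $$\mathrm{BSR}_T=\mathbb E\Bigl[f(x^*)-\max_{t\le T}f(x_t)\Bigr]$$ be the Bayesian simple regret. Let $$\gamma_T=\max_{a_1,\dots,a_T\in\mathcal X} I\bigl((f(a_i)+\epsilon_i)_{i\le T};\,(f(a_i))_{i\le T}\bigr)$$ be the maximum information gain, where the points $a_i$ may repeat and $I$ is the Shannon mutual information in nats. Put $C_1=2/\log(1+\sigma^{-2})$ and $C_2=2+s$. Then for every $\eta>0$ there is a smallest positive integer $T$ with $$\sqrt{\frac{C_1C_2\gamma_T}{T}}\le\eta ,$$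 and for this $T$ one has $\mathrm{BSR}_T\le\eta$ (the expectation being well defined); that is, IRGP-UCB reaches Bayesian simple regret at most $\eta$ within at most $T$ function evaluations. -/

import Mathlib

open MeasureTheory ProbabilityTheory
open scoped ENNReal NNReal Matrix

namespace GPBandit

/-! Evaluations are numbered `0, 1, 2, …`: the query with index `t` is the `(t + 1)`-st one and is
chosen from the `t` data points with indices `0, …, t - 1`. -/

section Posterior

variable {X : Type*}

/-- A kernel on a finite set of points of `ℝᵈ` is stationary if `k x x'` depends on `x - x'` only. -/
def IsStationary {d : ℕ} {D : Finset (EuclideanSpace ℝ (Fin d))} (k : D → D → ℝ) : Prop :=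
  ∃ φ : EuclideanSpace ℝ (Fin d) → ℝ,
    ∀ x x' : D, k x x' = φ ((x : EuclideanSpace ℝ (Fin d)) - (x' : EuclideanSpace ℝ (Fin d)))

/-- The vector `(k(x, a₀), …, k(x, a_{t-1}))`. -/
def kernelVec (k : X → X → ℝ) {t : ℕ} (a : Fin t → X) (x : X) : Fin t → ℝ :=
  fun i => k x (a i)

/-- The kernel matrix of the points `a₀, …, a_{t-1}`. -/
def kernelMatrix (k : X → X → ℝ) {t : ℕ} (a : Fin t → X) : Matrix (Fin t) (Fin t) ℝ :=
  Matrix.of fun i j => k (a i) (a j)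

/-- Posterior mean `k(x)ᵀ (K + σ² I)⁻¹ y`. -/
noncomputable def postMean (k : X → X → ℝ) (σ : ℝ) {t : ℕ} (a : Fin t → X) (y : Fin t → ℝ)
    (x : X) : ℝ :=
  kernelVec k a x ⬝ᵥ
    ((kernelMatrix k a + σ ^ 2 • (1 : Matrix (Fin t) (Fin t) ℝ))⁻¹ *ᵥ y)

/-- Posterior variance `k(x, x) - k(x)ᵀ (K + σ² I)⁻¹ k(x)`. -/
noncomputable def postVar (k : X → X → ℝ) (σ : ℝ) {t : ℕ} (a : Fin t → X) (x : X) : ℝ :=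
  k x x - kernelVec k a x ⬝ᵥ
    ((kernelMatrix k a + σ ^ 2 • (1 : Matrix (Fin t) (Fin t) ℝ))⁻¹ *ᵥ kernelVec k a x)

/-- The upper confidence bound `μ(x) + ζ^{1/2} σ(x)` computed from the data `(aᵢ, yᵢ)`, where
`σ(x)` is the posterior standard deviation. -/
noncomputable def ucb (k : X → X → ℝ) (σ : ℝ) {t : ℕ} (a : Fin t → X) (y : Fin t → ℝ) (ζ : ℝ)
    (x : X) : ℝ :=
  postMean k σ a y x + √ζ * √(postVar k σ a x)

end Posterior

/-- The two-parameter exponential distribution: the law of `s + Z` with `Z ∼ Exp(lam)`. -/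
noncomputable def twoParamExp (s lam : ℝ) : Measure ℝ :=
  (expMeasure lam).map (fun z => s + z)

section Model

variable {Ω X 𝒰 : Type*} [MeasurableSpace Ω]

/-- `f` is a Gaussian process with mean zero and covariance `k`, `ε` is a sequence of i.i.d.
`N(0, σ²)` variables, and `f` and `ε` are independent. -/
structure IsGPModel (P : Measure Ω) (k : X → X → ℝ) (σ : ℝ) (f : X → Ω → ℝ) (ε : ℕ → Ω → ℝ) :
    Prop where
  measurable_f : ∀ x, Measurable (f x)
  gaussian_f : IsGaussianProcess f P
  mean_f : ∀ x, ∫ ω, f x ω ∂P = 0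
  cov_f : ∀ x x', covariance (f x) (f x') P = k x x'
  measurable_noise : ∀ t, Measurable (ε t)
  law_noise : ∀ t, HasLaw (ε t) (gaussianReal 0 (σ ^ 2).toNNReal) P
  iIndep_noise : iIndepFun ε P
  indep_f_noise : IndepFun (fun ω x => f x ω) (fun ω t => ε t ω) P

/-- The observation `y_t = f(x_t) + ε_t`. -/
def obs (f : X → Ω → ℝ) (ε : ℕ → Ω → ℝ) (x : ℕ → Ω → X) (t : ℕ) (ω : Ω) : ℝ :=
  f (x t ω) ω + ε t ω

/-- Everything the algorithm knows when it chooses its query with index `t`: its internal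
randomness `U` for breaking ties, `ζ₀, …, ζ_t`, and the data `(xᵢ, yᵢ)`, `i < t`. -/
def history (f : X → Ω → ℝ) (ε ζ : ℕ → Ω → ℝ) (U : Ω → 𝒰) (x : ℕ → Ω → X) (t : ℕ) (ω : Ω) :
    𝒰 × (Fin (t + 1) → ℝ) × (Fin t → X) × (Fin t → ℝ) :=
  (U ω, fun i => ζ i ω, fun i => x i ω, fun i => obs f ε x i ω)

/-- `x` is the sequence of queries of IRGP-UCB with parameters `s` and `lam`. The `ζ_t` are drawn
independently of each other and of everything else from the two-parameter exponential
distribution, and `x_t` is a maximizer of the upper confidence bound with parameter `ζ_t`. Ties may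
be broken in any non-anticipating way, possibly with the help of a random element `U` that is
independent of `f`, `ε` and `ζ`. -/
structure IsIRGPUCB [MeasurableSpace X] [MeasurableSpace 𝒰] (P : Measure Ω) (k : X → X → ℝ)
    (σ s lam : ℝ) (f : X → Ω → ℝ) (ε ζ : ℕ → Ω → ℝ) (U : Ω → 𝒰) (x : ℕ → Ω → X) : Prop where
  measurable_zeta : ∀ t, Measurable (ζ t)
  law_zeta : ∀ t, HasLaw (ζ t) (twoParamExp s lam) P
  iIndep_zeta : iIndepFun ζ P
  measurable_U : Measurable U
  indep_zeta_U : IndepFun (fun ω t => ζ t ω) U P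
  indep_env : IndepFun (fun ω => ((fun x => f x ω : X → ℝ), (fun t => ε t ω : ℕ → ℝ)))
    (fun ω => ((fun t => ζ t ω : ℕ → ℝ), U ω)) P
  nonanticipating : ∀ t, Measurable[MeasurableSpace.comap (history f ε ζ U x t) inferInstance] (x t)
  argmax : ∀ t ω x', ucb k σ (fun i : Fin t => x i ω) (fun i : Fin t => obs f ε x i ω) (ζ t ω) x' ≤
    ucb k σ (fun i : Fin t => x i ω) (fun i : Fin t => obs f ε x i ω) (ζ t ω) (x t ω)

/-- Shannon mutual information `I(Y; Z)` (in nats): the Kullback-Leibler divergence of the joint law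
from the product of the marginal laws. -/
noncomputable def mutualInfo {E F : Type*} [MeasurableSpace E] [MeasurableSpace F]
    (P : Measure Ω) (Y : Ω → E) (Z : Ω → F) : ℝ≥0∞ :=
  InformationTheory.klDiv (P.map fun ω => (Y ω, Z ω)) ((P.map Y).prod (P.map Z))

/-- Maximum information gain: the largest `I(y_A; f_A)` over all choices of `T` points
`a₀, …, a_{T-1}` of the domain, repetitions allowed, with `f_A = (f(aᵢ))ᵢ` and
`y_A = (f(aᵢ) + εᵢ)ᵢ`. It depends on `f` and `ε` through their law only. -/
noncomputable def maxInfoGain (P : Measure Ω) (f : X → Ω → ℝ) (ε : ℕ → Ω → ℝ) (T : ℕ) : ℝ≥0∞ :=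
  ⨆ a : Fin T → X,
    mutualInfo P (fun ω (i : Fin T) => f (a i) ω + ε i ω) (fun ω (i : Fin T) => f (a i) ω)

/-- The simple regret `max_x f(x) - max_{t < T} f(x_t)`, for a finite non-empty domain and
`T` positive. -/
noncomputable def simpleRegret (f : X → Ω → ℝ) (x : ℕ → Ω → X) (T : ℕ) (ω : Ω) : ℝ :=
  (⨆ x' : X, f x' ω) - ⨆ t : Fin T, f (x t ω) ω

/-- The Bayesian simple regret after `T` evaluations. -/
noncomputable def BSR (P : Measure Ω) (f : X → Ω → ℝ) (x : ℕ → Ω → X) (T : ℕ) : ℝ :=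
  ∫ ω, simpleRegret f x T ω ∂P

end Model

end GPBandit

/-! The regret bound is a comparison of tails. Fix the points queried before round `t` and split `f
= m + R`, with `m` the posterior mean and `R` the residual. Each `R b` is centred Gaussian with
variance `postVar`, and the whole residual is independent of the observations and of the internal
randomness (`IsIRGPUCB.indepFun_residual`). For `z ≥ s` put `h z = ⨆ b, (m b + √z * √(postVar b))`.
The Gaussian tail bound and a union bound give `P (⨆ b, f b > h z) ≤ |X| exp (-z/2) / 2`, and `s` is
chosen so that the right side equals `P (ζ > z)`. Hence the maximum of `f` is dominated in
expectation by `h ζ`, the largest upper confidence bound (`integral_iSup_le_integral_ucb`).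

The algorithm attains that bound at `x t`, where the posterior mean equals `f` minus a residual of
mean zero (`IsIRGPUCB.setIntegral_residual`). So the expected instantaneous regret is at most the
expectation of `√ζ * √postVar` at the queried point (`IsIRGPUCB.integral_regret_le`). No conditional
expectations are needed: the domain is finite, so expectations split over the finitely many query
paths of length `t`, and on each path the data are observations at fixed points.

Simple regret is at most every instantaneous regret, hence at most their average. A weighted AM-GM
inequality separates `E ζ = 2 + s` from the sum of posterior variances. A Schur complement
factorises the determinant of the noisy Gram matrix into the terms `postVar + σ ^ 2`, and concavity
of the logarithm bounds that sum by `C₁` times the information gain (`sum_postVar_le`). The Shannon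
information is identified with this log-determinant in `mutualInfo_signal_noise`.

A suitable `T` exists because the information gain grows only logarithmically: the relevant
determinant reduces to one of fixed size `|X|` with entries linear in the number of observations
(`gaussInfo_le`). -/

namespace GPBandit

/-! ### Densities of independent Gaussian variables and their entropy -/

section Density

variable {ι : Type*} [Fintype ι]

/-- A product of copies of a law with a density has the product density. -/
theorem pi_withDensity {g : ℝ → ℝ} (hg0 : ∀ x, 0 ≤ g x)
    (hgi : Integrable g) :
    Measure.pi (fun _ : ι => (volume : Measure ℝ).withDensity fun x => ENNReal.ofReal (g x)) =
      (volume : Measure (ι → ℝ)).withDensity fun x => ENNReal.ofReal (∏ i, g (x i)) := by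
  have hfin : IsFiniteMeasure ((volume : Measure ℝ).withDensity fun x => ENNReal.ofReal (g x)) :=
    isFiniteMeasure_withDensity_ofReal hgi.2
  refine Measure.pi_eq fun s hs => ?_
  have hprod : ∀ x : ι → ℝ, (Set.univ.pi s).indicator (fun x => ∏ i, g (x i)) x
      = ∏ i, (s i).indicator g (x i) := by
    intro x
    by_cases hx : x ∈ Set.univ.pi s
    · rw [Set.indicator_of_mem hx]
      exact Finset.prod_congr rfl fun i _ => (Set.indicator_of_mem (hx i trivial) _).symm
    · rw [Set.indicator_of_notMem hx]
      simp only [Set.mem_pi, Set.mem_univ, true_implies, not_forall] at hx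
      obtain ⟨i, hi⟩ := hx
      exact (Finset.prod_eq_zero (Finset.mem_univ i) (Set.indicator_of_notMem hi _)).symm
  have hms : MeasurableSet (Set.univ.pi s) := MeasurableSet.univ_pi hs
  have hint : Integrable (fun x : ι → ℝ => ∏ i, g (x i)) :=
    Integrable.fintype_prod (f := fun _ : ι => g) fun _ => hgi
  rw [withDensity_apply _ hms, ← ofReal_integral_eq_lintegral_ofReal hint.integrableOn
    (Filter.Eventually.of_forall fun x => Finset.prod_nonneg fun _ _ => hg0 _),
    ← integral_indicator hms]
  simp_rw [hprod]
  rw [integral_fintype_prod_volume_eq_prod (fun i => (s i).indicator g),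
    ENNReal.ofReal_prod_of_nonneg fun i _ =>
      integral_nonneg fun x => Set.indicator_nonneg (fun x _ => hg0 x) x]
  refine Finset.prod_congr rfl fun i _ => ?_
  rw [withDensity_apply _ (hs i), integral_indicator (hs i), ofReal_integral_eq_lintegral_ofReal
    hgi.integrableOn (Filter.Eventually.of_forall hg0)]

/-- The density of `n` independent `N(0, v)` variables. -/
noncomputable def piGaussianPDF (v : ℝ≥0) (x : ι → ℝ) : ℝ := ∏ i, gaussianPDFReal 0 v (x i)

theorem piGaussianPDF_pos {v : ℝ≥0} (hv : v ≠ 0) (x : ι → ℝ) : 0 < piGaussianPDF v x :=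
  Finset.prod_pos fun _ _ => gaussianPDFReal_pos 0 v _ hv

@[fun_prop]
theorem measurable_piGaussianPDF (v : ℝ≥0) : Measurable (piGaussianPDF v : (ι → ℝ) → ℝ) :=
  Finset.measurable_prod _ fun i _ => (measurable_gaussianPDFReal 0 v).comp (measurable_pi_apply i)

theorem pi_gaussianReal {v : ℝ≥0} (hv : v ≠ 0) :
    Measure.pi (fun _ : ι => gaussianReal 0 v) =
      (volume : Measure (ι → ℝ)).withDensity fun x => ENNReal.ofReal (piGaussianPDF v x) := by
  simp_rw [gaussianReal_of_var_ne_zero 0 hv]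
  exact pi_withDensity (gaussianPDFReal_nonneg 0 v) (integrable_gaussianPDFReal 0 v)

theorem log_piGaussianPDF {v : ℝ≥0} (hv : v ≠ 0) (x : ι → ℝ) :
    Real.log (piGaussianPDF v x) =
      ∑ i, (-(Real.log (2 * Real.pi * v) / 2) - x i ^ 2 / (2 * v)) := by
  rw [piGaussianPDF, Real.log_prod fun _ _ => (gaussianPDFReal_pos 0 v _ hv).ne']
  refine Finset.sum_congr rfl fun i _ => ?_
  have hv' : (0 : ℝ) < v := by positivity
  rw [gaussianPDFReal, Real.log_mul (by positivity) (Real.exp_pos _).ne', Real.log_exp,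
    Real.log_inv, Real.log_sqrt (by positivity)]
  ring

variable {Ω : Type*} [MeasurableSpace Ω] {P : Measure Ω}

theorem integrable_sq_of_law {v : ℝ≥0} {X : Ω → ℝ} (h : P.map X = gaussianReal 0 v)
    (hX : Measurable X) : Integrable (fun ω => X ω ^ 2) P ∧ ∫ ω, X ω ^ 2 ∂P = v := by
  have h2 : MemLp id 2 (gaussianReal 0 v) := memLp_id_gaussianReal' 2 (by simp)
  have hi : Integrable (fun x : ℝ => x ^ 2) (P.map X) := by rw [h]; exact h2.integrable_sq
  refine ⟨hi.comp_measurable hX, ?_⟩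
  have := integral_map (f := fun x : ℝ => x ^ 2) hX.aemeasurable (hi.1)
  rw [← this, h]
  have hvar := variance_eq_sub h2
  rw [variance_id_gaussianReal] at hvar
  simpa using hvar.symm

theorem integrable_log_piGaussianPDF [IsProbabilityMeasure P] {v : ℝ≥0} (hv : v ≠ 0) {X : ι → Ω → ℝ}
    (h : ∀ i, P.map (X i) = gaussianReal 0 v) (hX : ∀ i, Measurable (X i)) :
    Integrable (fun ω => Real.log (piGaussianPDF v fun i => X i ω)) P ∧
      ∫ ω, Real.log (piGaussianPDF v fun i => X i ω) ∂P =
        -(Fintype.card ι * (Real.log (2 * Real.pi * v) / 2 + 1 / 2)) := by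
  simp_rw [log_piGaussianPDF hv]
  have hi : ∀ i, Integrable
      (fun ω => -(Real.log (2 * Real.pi * v) / 2) - X i ω ^ 2 / (2 * v)) P := fun i =>
    (integrable_const _).sub ((integrable_sq_of_law (h i) (hX i)).1.div_const _)
  refine ⟨integrable_finsetSum _ fun i _ => hi i, ?_⟩
  rw [integral_finsetSum _ fun i _ => hi i]
  have : ∀ i, ∫ ω, (-(Real.log (2 * Real.pi * v) / 2) - X i ω ^ 2 / (2 * v)) ∂P
      = -(Real.log (2 * Real.pi * v) / 2 + 1 / 2) := by
    intro i
    rw [integral_sub (integrable_const _) ((integrable_sq_of_law (h i) (hX i)).1.div_const _),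
      integral_div, (integrable_sq_of_law (h i) (hX i)).2]
    have hv' : (v : ℝ) ≠ 0 := by positivity
    simp
    field_simp
    ring
  simp [this]
  ring

end Density

/-! ### Transport of densities and Kullback-Leibler divergence -/

theorem map_withDensity_equiv {α β : Type*} [MeasurableSpace α] [MeasurableSpace β]
    (e : α ≃ᵐ β) (μ : Measure α) (g : α → ℝ≥0∞) :
    (μ.withDensity g).map e = (μ.map e).withDensity (g ∘ e.symm) := by
  ext s hs
  rw [e.map_apply, withDensity_apply _ (e.measurable hs), withDensity_apply _ hs,
    e.restrict_map, lintegral_map_equiv]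
  simp

/-- The divergence of a probability measure with a positive density. -/
theorem klDiv_withDensity_pos {α : Type*} [MeasurableSpace α] {μ ν : Measure α}
    [IsProbabilityMeasure μ] [IsProbabilityMeasure ν] {g : α → ℝ} (hg : Measurable g)
    (h : μ = ν.withDensity fun x => ENNReal.ofReal (g x)) (hpos : ∀ x, 0 < g x)
    (hi : Integrable (fun x => Real.log (g x)) μ) :
    InformationTheory.klDiv μ ν = ENNReal.ofReal (∫ x, Real.log (g x) ∂μ) := by
  have hac : μ ≪ ν := h ▸ withDensity_absolutelyContinuous _ _
  have hr : llr μ ν =ᵐ[μ] fun x => Real.log (g x) := by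
    have := hac.ae_le (h ▸ Measure.rnDeriv_withDensity ν (f := fun x => ENNReal.ofReal (g x))
      (by fun_prop))
    filter_upwards [this] with x hx
    rw [llr, hx, ENNReal.toReal_ofReal (hpos x).le]
  rw [InformationTheory.klDiv_of_ac_of_integrable hac (hi.congr hr.symm), integral_congr_ae hr]
  simp

/-! ### Whitening and the density of a Gaussian vector -/

section GaussianVector

-- Factor `S = Aᵀ * A` with `A` invertible; then `(A⁻¹)ᵀ` works.
open scoped MatrixOrder in
theorem exists_whitening {ι : Type*} [Fintype ι] [DecidableEq ι] {S : Matrix ι ι ℝ}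
    (hS : S.PosDef) : ∃ B : Matrix ι ι ℝ, B * S * Bᵀ = 1 := by
  obtain ⟨A, hA⟩ := CStarAlgebra.nonneg_iff_eq_star_mul_self.mp hS.posSemidef.nonneg
  rw [Matrix.star_eq_conjTranspose, Matrix.conjTranspose_eq_transpose_of_trivial] at hA
  have hdet : IsUnit A.det := by
    have h := hS.det_pos
    rw [hA, Matrix.det_mul, Matrix.det_transpose] at h
    exact isUnit_iff_ne_zero.mpr fun h0 => by simp [h0] at h
  refine ⟨(A⁻¹)ᵀ, ?_⟩
  rw [Matrix.transpose_transpose, hA, ← Matrix.mul_assoc, ← Matrix.transpose_mul,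
    Matrix.mul_nonsing_inv _ hdet, Matrix.transpose_one, Matrix.one_mul,
    Matrix.mul_nonsing_inv _ hdet]

variable {Ω ι : Type*} [MeasurableSpace Ω] [Fintype ι]
  {P : Measure Ω}

theorem law_eq_gaussianReal {X : Ω → ℝ} (hX : HasGaussianLaw X P) (h0 : ∫ ω, X ω ∂P = 0)
    {v : ℝ} (hv : covariance X X P = v) : P.map X = gaussianReal 0 v.toNNReal := by
  rw [hX.map_eq_gaussianReal, h0, ← hv, covariance_self hX.aemeasurable]

variable [IsProbabilityMeasure P] [DecidableEq ι]

/-- Uncorrelated components of a jointly Gaussian vector are independent. -/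
theorem law_pi_of_covariance_one {W : ι → Ω → ℝ} (hW : HasGaussianLaw (fun ω i => W i ω) P)
    (h0 : ∀ i, ∫ ω, W i ω ∂P = 0)
    (hc : ∀ i j, covariance (W i) (W j) P = (1 : Matrix ι ι ℝ) i j) :
    (∀ i, P.map (W i) = gaussianReal 0 1) ∧
      P.map (fun ω i => W i ω) = Measure.pi fun _ => gaussianReal 0 1 := by
  have h1 : ∀ i, P.map (W i) = gaussianReal 0 1 := fun i => by
    simpa using law_eq_gaussianReal (hW.eval i) (h0 i) (hc i i)
  refine ⟨h1, ?_⟩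
  have := (iIndepFun_iff_map_fun_eq_pi_map fun i => (hW.eval i).aemeasurable).1
    (hW.iIndepFun_of_covariance_eq_zero fun i j hij => by rw [hc, Matrix.one_apply_ne hij])
  simpa [h1] using this

/-- A centred Gaussian vector with invertible covariance matrix is whitened by a matrix `B`, and its
density is expressed through `B`. -/
theorem gaussianVector_density {Y : ι → Ω → ℝ} (hY : HasGaussianLaw (fun ω i => Y i ω) P)
    (hYm : ∀ i, Measurable (Y i)) (h0 : ∀ i, ∫ ω, Y i ω ∂P = 0) {S : Matrix ι ι ℝ}
    (hc : ∀ i j, covariance (Y i) (Y j) P = S i j) {B : Matrix ι ι ℝ} (hB : B * S * Bᵀ = 1) :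
    (∀ i, P.map (fun ω => (B *ᵥ fun j => Y j ω) i) = gaussianReal 0 1) ∧
    P.map (fun ω i => Y i ω) = (volume : Measure (ι → ℝ)).withDensity fun y =>
      ENNReal.ofReal (|B.det| * piGaussianPDF 1 (B *ᵥ y)) := by
  have hYL : ∀ i, MemLp (Y i) 2 P := fun i => (hY.eval i).memLp_two
  have hBu : IsUnit B.det := by
    have h := congrArg Matrix.det hB
    rw [Matrix.det_mul, Matrix.det_mul, Matrix.det_one] at h
    exact isUnit_iff_ne_zero.mpr fun h0 => by simp [h0] at h
  let W : ι → Ω → ℝ := fun i ω => (B *ᵥ fun j => Y j ω) i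
  have hWi : ∀ i, W i = fun ω => ∑ j, B i j * Y j ω := fun i => rfl
  have hW : HasGaussianLaw (fun ω i => W i ω) P :=
    hY.map_fun (Matrix.toLin' B).toContinuousLinearMap
  have hlaw := law_pi_of_covariance_one hW
    (fun i => by
      rw [hWi, integral_finsetSum _ fun j _ => ((hYL j).integrable (by norm_num)).const_mul _]
      simp [integral_const_mul, h0])
    (fun i j => by
      rw [hWi, hWi, covariance_fun_sum_fun_sum (fun k => (hYL k).const_mul _)
        (fun k => (hYL k).const_mul _), ← hB, Matrix.mul_apply]
      simp only [covariance_const_mul_left, covariance_const_mul_right, hc,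
        Matrix.mul_apply, Matrix.transpose_apply, Finset.sum_mul]
      rw [Finset.sum_comm]
      exact Finset.sum_congr rfl fun k _ => Finset.sum_congr rfl fun l _ => by ring)
  refine ⟨hlaw.1, ?_⟩
  let e : (ι → ℝ) ≃ᵐ (ι → ℝ) := (Matrix.toLin'OfInv (Matrix.mul_nonsing_inv B hBu)
    (Matrix.nonsing_inv_mul B hBu)).toContinuousLinearEquiv.toHomeomorph.toMeasurableEquiv
  have he : ∀ w, e w = B⁻¹ *ᵥ w := fun w => rfl
  have hes : ∀ w, e.symm w = B *ᵥ w := fun w => rfl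
  have hYW : (fun ω i => Y i ω) = e ∘ fun ω i => W i ω := by
    ext ω : 1
    simp only [Function.comp_apply]
    rw [eq_comm, ← MeasurableEquiv.eq_symm_apply, hes]
  have hev : (volume : Measure (ι → ℝ)).map e = ENNReal.ofReal |B.det| • volume := by
    have h := Real.map_matrix_volume_pi_eq_smul_volume_pi (M := B⁻¹)
      (by rw [Matrix.det_nonsing_inv]; simpa using hBu.ne_zero)
    rw [Matrix.det_nonsing_inv, Ring.inverse_eq_inv', inv_inv] at h
    exact h
  have hWm : Measurable fun ω i => W i ω := by
    refine measurable_pi_lambda _ fun i => ?_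
    rw [hWi]; fun_prop
  rw [hYW, ← Measure.map_map e.measurable hWm, hlaw.2, pi_gaussianReal one_ne_zero,
    map_withDensity_equiv, hev, withDensity_smul_measure, ← withDensity_smul]
  · congr 1
    ext y
    simp [hes, ENNReal.ofReal_mul]
  · have := e.symm.measurable
    fun_prop

end GaussianVector

/-! ### Information carried by noisy observations -/

section MutualInformation

variable {Ω ι : Type*} [MeasurableSpace Ω] {P : Measure Ω}

theorem covariance_signal_noise [IsProbabilityMeasure P] [DecidableEq ι] {F e : ι → Ω → ℝ}
    (hF : HasGaussianLaw (fun ω i => F i ω) P) {v : ℝ≥0}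
    (hel : ∀ i, P.map (e i) = gaussianReal 0 v) (hem : ∀ i, Measurable (e i))
    (hei : iIndepFun e P) (hFe : IndepFun (fun ω i => F i ω) (fun ω i => e i ω) P)
    {K : Matrix ι ι ℝ} (hc : ∀ i j, covariance (F i) (F j) P = K i j) (i j : ι) :
    covariance (fun ω => F i ω + e i ω) (fun ω => F j ω + e j ω) P =
      (K + (v : ℝ) • (1 : Matrix ι ι ℝ)) i j := by
  have hFL : ∀ i, MemLp (F i) 2 P := fun i => (hF.eval i).memLp_two
  have heL : ∀ i, MemLp (e i) 2 P := fun i =>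
    (HasLaw.hasGaussianLaw ⟨(hem i).aemeasurable, hel i⟩ : HasGaussianLaw (e i) P).memLp_two
  have hcross : ∀ i j, covariance (F i) (e j) P = 0 := fun i j =>
    (hFe.comp (measurable_pi_apply i) (measurable_pi_apply j)).covariance_eq_zero (hFL i) (heL j)
  have hnoise : covariance (e i) (e j) P = ((v : ℝ) • (1 : Matrix ι ι ℝ)) i j := by
    rcases eq_or_ne i j with rfl | hij
    · have h := variance_map (X := id) (Y := e i) (μ := P) (by fun_prop) (hem i).aemeasurable
      rw [hel, variance_id_gaussianReal] at h
      rw [covariance_self (hem i).aemeasurable]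
      simpa using h.symm
    · rw [(hei.indepFun hij).covariance_eq_zero (heL i) (heL j)]
      simp [hij]
  change covariance (F i + e i) (F j + e j) P = _
  rw [covariance_add_left (hFL i) (heL i) ((hFL j).add (heL j)),
    covariance_add_right (hFL i) (hFL j) (heL j), covariance_add_right (heL i) (hFL j) (heL j),
    hc, hcross, covariance_comm, hcross, hnoise]
  simp

variable [Fintype ι]

theorem hasGaussianLaw_signal_noise {κ : Type*} [Fintype κ] {F : κ → Ω → ℝ} {e : ι → Ω → ℝ}
    (hF : HasGaussianLaw (fun ω i => F i ω) P) {v : ℝ≥0}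
    (hel : ∀ i, P.map (e i) = gaussianReal 0 v) (hem : ∀ i, Measurable (e i))
    (hei : iIndepFun e P) (hFe : IndepFun (fun ω i => F i ω) (fun ω i => e i ω) P) :
    HasGaussianLaw (fun ω => ((fun i => F i ω), fun i => e i ω)) P :=
  IndepFun.hasGaussianLaw hF
    (hei.hasGaussianLaw fun i => HasLaw.hasGaussianLaw ⟨(hem i).aemeasurable, hel i⟩) hFe

variable [IsProbabilityMeasure P] [DecidableEq ι]

set_option maxHeartbeats 800000 in
/-- The information that noisy observations carry about a Gaussian vector, possibly degenerate. -/
theorem mutualInfo_signal_noise {F e : ι → Ω → ℝ}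
    (hF : HasGaussianLaw (fun ω i => F i ω) P) (hFm : ∀ i, Measurable (F i))
    (hF0 : ∀ i, ∫ ω, F i ω ∂P = 0) {v : ℝ≥0} (hv : v ≠ 0)
    (hel : ∀ i, P.map (e i) = gaussianReal 0 v) (hem : ∀ i, Measurable (e i))
    (hei : iIndepFun e P) (hFe : IndepFun (fun ω i => F i ω) (fun ω i => e i ω) P)
    {K : Matrix ι ι ℝ} (hc : ∀ i j, covariance (F i) (F j) P = K i j)
    (hS : (K + (v : ℝ) • (1 : Matrix ι ι ℝ)).PosDef) :
    mutualInfo P (fun ω i => F i ω + e i ω) (fun ω i => F i ω) =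
      ENNReal.ofReal ((Real.log (K + (v : ℝ) • (1 : Matrix ι ι ℝ)).det
        - Fintype.card ι * Real.log v) / 2) := by
  obtain ⟨B, hB⟩ := exists_whitening hS
  have hBdet : B.det ^ 2 * (K + (v : ℝ) • (1 : Matrix ι ι ℝ)).det = 1 := by
    have h := congrArg Matrix.det hB
    rw [Matrix.det_mul, Matrix.det_mul, Matrix.det_one, Matrix.det_transpose] at h
    linarith
  have hB0 : B.det ≠ 0 := fun h => by simp [h] at hBdet
  have hYm : ∀ i, Measurable fun ω => F i ω + e i ω := fun i => (hFm i).add (hem i)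
  have hY : HasGaussianLaw (fun ω i => F i ω + e i ω) P :=
    (hasGaussianLaw_signal_noise hF hel hem hei hFe).fun_add
  have he0 : ∀ i, Integrable (e i) P ∧ ∫ ω, e i ω ∂P = 0 := fun i => by
    refine ⟨(HasLaw.hasGaussianLaw ⟨(hem i).aemeasurable, hel i⟩ :
      HasGaussianLaw (e i) P).integrable, ?_⟩
    have h := integral_map (μ := P) (f := fun x : ℝ => x) (hem i).aemeasurable (by fun_prop)
    rw [hel, integral_id_gaussianReal] at h
    exact h.symm
  obtain ⟨hW, hYlaw⟩ := gaussianVector_density hY hYm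
    (fun i => by
      rw [integral_add (hF.eval i).integrable (he0 i).1, hF0, (he0 i).2, add_zero])
    (covariance_signal_noise hF hel hem hei hFe hc) hB
  have hFvm : Measurable fun ω i => F i ω := measurable_pi_lambda _ hFm
  have hevm : Measurable fun ω i => e i ω := measurable_pi_lambda _ hem
  have hYvm : Measurable fun ω i => F i ω + e i ω := measurable_pi_lambda _ hYm
  set PF := P.map fun ω i => F i ω with hPF
  have : IsProbabilityMeasure PF := Measure.isProbabilityMeasure_map hFvm.aemeasurable
  have helaw : P.map (fun ω i => e i ω) = (volume : Measure (ι → ℝ)).withDensity fun x =>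
      ENNReal.ofReal (piGaussianPDF v x) := by
    rw [(iIndepFun_iff_map_fun_eq_pi_map fun i => (hem i).aemeasurable).1 hei]
    simp_rw [hel]
    exact pi_gaussianReal hv
  have hBm : Measurable fun y : ι → ℝ => B *ᵥ y :=
    (Matrix.toLin' B).toContinuousLinearMap.measurable
  let p : (ι → ℝ) → ℝ := fun y => |B.det| * piGaussianPDF 1 (B *ᵥ y)
  have hp : ∀ y, 0 < p y := fun y => mul_pos (abs_pos.mpr hB0) (piGaussianPDF_pos one_ne_zero _)
  have hpm : Measurable p := ((measurable_piGaussianPDF 1).comp hBm).const_mul _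
  -- Conditional density of the observations given the signal, divided by their marginal density.
  -- Only the observations need a Lebesgue density, so the signal may be degenerate.
  let g : (ι → ℝ) × (ι → ℝ) → ℝ := fun z => piGaussianPDF v (z.1 - z.2) / p z.1
  have hgm : Measurable g := by
    refine Measurable.div ((measurable_piGaussianPDF v).comp (by fun_prop)) (hpm.comp measurable_fst)
  have hgpos : ∀ z, 0 < g z := fun z => div_pos (piGaussianPDF_pos hv _) (hp _)
  let shear : (ι → ℝ) × (ι → ℝ) ≃ᵐ (ι → ℝ) × (ι → ℝ) :=
    { toFun := fun z => (z.1 + z.2, z.2)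
      invFun := fun z => (z.1 - z.2, z.2)
      left_inv := fun z => by simp
      right_inv := fun z => by simp
      measurable_toFun := by
        change Measurable fun z : (ι → ℝ) × (ι → ℝ) => (z.1 + z.2, z.2)
        fun_prop
      measurable_invFun := by
        change Measurable fun z : (ι → ℝ) × (ι → ℝ) => (z.1 - z.2, z.2)
        fun_prop }
  -- On every fibre over a signal value the shear is a translation, which preserves Lebesgue
  -- measure.
  have hshear : ((volume : Measure (ι → ℝ)).prod PF).map shear = volume.prod PF := by
    refine Measure.ext fun s hs => ?_
    rw [shear.map_apply, Measure.prod_apply_symm (shear.measurable hs), Measure.prod_apply_symm hs]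
    refine lintegral_congr fun y => ?_
    exact measure_preimage_add_right volume y ((fun x => (x, y)) ⁻¹' s)
  have hjoint : P.map (fun ω => ((fun i => F i ω + e i ω), fun i => F i ω)) =
      ((P.map fun ω i => F i ω + e i ω).prod PF).withDensity fun z => ENNReal.ofReal (g z) := by
    have h1 : P.map (fun ω => ((fun i => F i ω + e i ω), fun i => F i ω)) =
        (P.map (fun ω => ((fun i => e i ω), fun i => F i ω))).map shear := by
      rw [Measure.map_map shear.measurable (hevm.prodMk hFvm)]
      congr 1
      ext ω : 1
      refine Prod.ext (funext fun i => ?_) rfl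
      exact add_comm _ _
    have h2 := (indepFun_iff_map_prod_eq_prod_map_map hevm.aemeasurable hFvm.aemeasurable).1 hFe.symm
    rw [h1, h2, helaw, hYlaw, prod_withDensity_left (by fun_prop), map_withDensity_equiv, hshear,
      prod_withDensity_left (hpm.ennreal_ofReal), ← withDensity_mul]
    · congr 1
      ext z
      rw [Pi.mul_apply, ← ENNReal.ofReal_mul (hp _).le]
      change ENNReal.ofReal (piGaussianPDF v (z.1 - z.2)) = _
      rw [mul_div_cancel₀ _ (hp _).ne']
    · exact (hpm.comp measurable_fst).ennreal_ofReal
    · exact hgm.ennreal_ofReal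
  have hjm : Measurable fun ω => ((fun i => F i ω + e i ω), fun i => F i ω) := hYvm.prodMk hFvm
  have hlogg : ∀ ω, Real.log (g ((fun i => F i ω + e i ω), fun i => F i ω)) =
      Real.log (piGaussianPDF v fun i => e i ω) - (Real.log |B.det| +
        Real.log (piGaussianPDF 1 fun i => (B *ᵥ fun j => F j ω + e j ω) i)) := by
    intro ω
    have hdiff : (fun i => F i ω + e i ω) - (fun i => F i ω) = fun i => e i ω :=
      funext fun i => add_sub_cancel_left _ _
    change Real.log (piGaussianPDF v ((fun i => F i ω + e i ω) - fun i => F i ω) /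
      (|B.det| * piGaussianPDF 1 (B *ᵥ fun i => F i ω + e i ω))) = _
    rw [hdiff, Real.log_div (piGaussianPDF_pos hv _).ne' (hp fun i => F i ω + e i ω).ne',
      Real.log_mul (abs_pos.mpr hB0).ne' (piGaussianPDF_pos one_ne_zero _).ne']
  have hWm : ∀ i, Measurable fun ω => (B *ᵥ fun j => F j ω + e j ω) i := fun i =>
    (measurable_pi_apply i).comp (hBm.comp hYvm)
  obtain ⟨hi1, hv1⟩ := integrable_log_piGaussianPDF hv hel hem
  obtain ⟨hi2, hv2⟩ := integrable_log_piGaussianPDF one_ne_zero hW hWm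
  have hint : Integrable (fun z => Real.log (g z))
      (P.map fun ω => ((fun i => F i ω + e i ω), fun i => F i ω)) := by
    rw [integrable_map_measure hgm.log.aestronglyMeasurable hjm.aemeasurable]
    exact (hi1.sub ((integrable_const _).add hi2)).congr
      (Filter.Eventually.of_forall fun ω => (hlogg ω).symm)
  have : IsProbabilityMeasure (P.map fun ω => ((fun i => F i ω + e i ω), fun i => F i ω)) :=
    Measure.isProbabilityMeasure_map hjm.aemeasurable
  have : IsProbabilityMeasure (P.map fun ω i => F i ω + e i ω) :=
    Measure.isProbabilityMeasure_map hYvm.aemeasurable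
  -- A difference of two Gaussian entropies; the terms `1/2` and `log (2π) / 2` per coordinate
  -- cancel in the end.
  have hval : ∫ z, Real.log (g z) ∂(P.map fun ω => ((fun i => F i ω + e i ω), fun i => F i ω)) =
      -(Fintype.card ι * (Real.log (2 * Real.pi * v) / 2 + 1 / 2)) - (Real.log |B.det| +
        -(Fintype.card ι * (Real.log (2 * Real.pi * (1 : ℝ≥0)) / 2 + 1 / 2))) := by
    refine (integral_map hjm.aemeasurable hgm.log.aestronglyMeasurable).trans ?_
    refine (integral_congr_ae (Filter.Eventually.of_forall hlogg)).trans ?_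
    refine (integral_sub hi1 ((integrable_const _).add hi2)).trans ?_
    rw [hv1]
    congr 1
    refine (integral_add (integrable_const _) hi2).trans ?_
    rw [hv2]
    simp
  have hlogdet : Real.log |B.det| = -(Real.log (K + (v : ℝ) • (1 : Matrix ι ι ℝ)).det / 2) := by
    have h := congrArg Real.log hBdet
    rw [Real.log_mul (pow_ne_zero 2 hB0) hS.det_pos.ne', Real.log_pow, Real.log_one] at h
    rw [Real.log_abs]
    push_cast at h
    linarith
  have hv' : (v : ℝ) ≠ 0 := by exact_mod_cast hv
  rw [mutualInfo, klDiv_withDensity_pos hgm hjoint hgpos hint, hval, hlogdet,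
    Real.log_mul (by positivity) hv', NNReal.coe_one, mul_one]
  congr 1
  ring

end MutualInformation

/-! ### Gaussian and exponential tails -/

section Tails

theorem gaussianReal_Ioi_zero_le : gaussianReal 0 1 (Set.Ioi 0) ≤ ENNReal.ofReal (1 / 2) := by
  have hsymm : gaussianReal 0 1 (Set.Iio 0) = gaussianReal 0 1 (Set.Ioi 0) := by
    have h := gaussianReal_map_neg (μ := 0) (v := 1)
    rw [neg_zero] at h
    conv_lhs => rw [← h, Measure.map_apply measurable_neg measurableSet_Iio]
    congr 1
    ext x
    simp
  have hsum : gaussianReal 0 1 (Set.Iio 0) + gaussianReal 0 1 (Set.Ioi 0) ≤ 1 := by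
    have hdisj : Disjoint (Set.Iio (0 : ℝ)) (Set.Ioi 0) :=
      Set.disjoint_left.mpr fun x hx hx' => lt_asymm (Set.mem_Iio.mp hx) (Set.mem_Ioi.mp hx')
    rw [← measure_union hdisj measurableSet_Ioi]
    exact prob_le_one
  rw [hsymm] at hsum
  have hreal := ENNReal.toReal_mono ENNReal.one_ne_top hsum
  rw [ENNReal.toReal_add (measure_ne_top _ _) (measure_ne_top _ _), ENNReal.toReal_one] at hreal
  rw [← ENNReal.ofReal_toReal (measure_ne_top (gaussianReal 0 1) (Set.Ioi 0))]
  exact ENNReal.ofReal_le_ofReal (by linarith)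

/-- Shift by `c`: for `x > 0`, `(x + c) ^ 2 ≥ x ^ 2 + c ^ 2`, so the shifted density is at most `exp
(-c ^ 2 / 2)` times the standard one, and the positive half-line has mass at most `1/2`. This factor
`1/2` is the source of `|X| / 2` in `s`. -/
theorem gaussianReal_Ioi_le {c : ℝ} (hc : 0 ≤ c) :
    gaussianReal 0 1 (Set.Ioi c) ≤ ENNReal.ofReal (Real.exp (-c ^ 2 / 2) / 2) := by
  have hshift : gaussianReal 0 1 (Set.Ioi c) = gaussianReal (-c) 1 (Set.Ioi 0) := by
    have h := gaussianReal_map_sub_const (μ := 0) (v := 1) c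
    rw [zero_sub] at h
    rw [← h, Measure.map_apply (by fun_prop) measurableSet_Ioi]
    congr 1
    ext x
    simp
  rw [hshift, gaussianReal_apply _ one_ne_zero]
  calc ∫⁻ x in Set.Ioi 0, gaussianPDF (-c) 1 x
      ≤ ∫⁻ x in Set.Ioi 0, ENNReal.ofReal (Real.exp (-c ^ 2 / 2)) * gaussianPDF 0 1 x := by
        refine setLIntegral_mono' measurableSet_Ioi fun x hx => ?_
        rw [gaussianPDF, gaussianPDF, ← ENNReal.ofReal_mul (Real.exp_pos _).le]
        refine ENNReal.ofReal_le_ofReal ?_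
        rw [gaussianPDFReal, gaussianPDFReal, mul_left_comm, ← Real.exp_add]
        have hx' : 0 < x := hx
        gcongr
        have := mul_nonneg hx'.le hc
        simp only [NNReal.coe_one, mul_one, sub_neg_eq_add, sub_zero]
        nlinarith
    _ = ENNReal.ofReal (Real.exp (-c ^ 2 / 2)) * gaussianReal 0 1 (Set.Ioi 0) := by
        rw [lintegral_const_mul _ (measurable_gaussianPDF 0 1), gaussianReal_apply _ one_ne_zero]
    _ ≤ ENNReal.ofReal (Real.exp (-c ^ 2 / 2)) * ENNReal.ofReal (1 / 2) := by
        gcongr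
        exact gaussianReal_Ioi_zero_le
    _ = _ := by
        rw [← ENNReal.ofReal_mul (Real.exp_pos _).le]
        congr 1
        ring

theorem gaussianReal_Ioi_sqrt_le (v : ℝ≥0) {z : ℝ} (hz : 0 ≤ z) :
    gaussianReal 0 v (Set.Ioi (√z * √v)) ≤ ENNReal.ofReal (Real.exp (-z / 2) / 2) := by
  -- Variance zero is a Dirac mass at `0`, which does not charge the open half-line.
  rcases eq_or_ne v 0 with rfl | hv
  · simp
  have hv' : 0 < √(v : ℝ) := Real.sqrt_pos.mpr (by positivity)
  have h := gaussianReal_map_const_mul (μ := 0) (v := 1) √(v : ℝ)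
  have hvar : NNReal.mk (√(v : ℝ) ^ 2) (sq_nonneg _) * 1 = v := by
    ext
    simp
  rw [hvar, mul_zero] at h
  rw [← h, Measure.map_apply (by fun_prop) measurableSet_Ioi]
  have hpre : (fun x => √(v : ℝ) * x) ⁻¹' Set.Ioi (√z * √v) = Set.Ioi √z := by
    ext x
    simp only [Set.mem_preimage, Set.mem_Ioi]
    rw [mul_comm √z, mul_lt_mul_iff_right₀ hv']
  rw [hpre]
  simpa [Real.sq_sqrt hz] using gaussianReal_Ioi_le (Real.sqrt_nonneg z)

theorem expMeasure_Ioi {r : ℝ} (hr : 0 < r) {t : ℝ} (ht : 0 ≤ t) :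
    expMeasure r (Set.Ioi t) = ENNReal.ofReal (Real.exp (-(r * t))) := by
  have := isProbabilityMeasure_expMeasure hr
  have h := cdf_expMeasure_eq hr t
  rw [if_pos ht, cdf_eq_real] at h
  rw [← Set.compl_Iic, prob_compl_eq_one_sub measurableSet_Iic,
    ← ENNReal.ofReal_toReal (measure_ne_top (expMeasure r) (Set.Iic t)), ← ENNReal.ofReal_one,
    ← ENNReal.ofReal_sub _ ENNReal.toReal_nonneg]
  congr 1
  rw [Measure.real] at h
  linarith

theorem ae_pos_expMeasure {r : ℝ} (hr : 0 < r) : ∀ᵐ x ∂expMeasure r, 0 < x := by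
  have := isProbabilityMeasure_expMeasure hr
  have h : expMeasure r (Set.Ioi 0) = 1 := by rw [expMeasure_Ioi hr le_rfl]; simp
  exact (prob_compl_eq_zero_iff measurableSet_Ioi).mpr h

theorem integrable_id_expMeasure {r : ℝ} (hr : 0 < r) :
    Integrable (fun x : ℝ => x) (expMeasure r) ∧ ∫ x, x ∂expMeasure r = r⁻¹ := by
  have hpos : 0 ≤ᵐ[expMeasure r] fun x : ℝ => x :=
    (ae_pos_expMeasure hr).mono fun x hx => hx.le
  have hI := integrableOn_exp_mul_Ioi (neg_neg_of_pos hr) 0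
  have hint : ∫⁻ x, ENNReal.ofReal x ∂expMeasure r = ENNReal.ofReal r⁻¹ := by
    rw [lintegral_eq_lintegral_meas_lt _ hpos aemeasurable_id']
    have hcongr : ∫⁻ t in Set.Ioi (0 : ℝ), expMeasure r {a | t < a} =
        ∫⁻ t in Set.Ioi (0 : ℝ), ENNReal.ofReal (Real.exp (-r * t)) := by
      refine setLIntegral_congr_fun measurableSet_Ioi fun t ht => ?_
      have h := expMeasure_Ioi hr (le_of_lt (Set.mem_Ioi.mp ht))
      rw [← neg_mul] at h
      exact h
    rw [hcongr, ← ofReal_integral_eq_lintegral_ofReal hI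
      (Filter.Eventually.of_forall fun _ => (Real.exp_pos _).le),
      integral_exp_mul_Ioi (neg_neg_of_pos hr)]
    simp
  refine ⟨⟨by fun_prop, ?_⟩, ?_⟩
  · rw [hasFiniteIntegral_iff_ofReal hpos, hint]
    exact ENNReal.ofReal_lt_top
  · rw [integral_eq_lintegral_of_nonneg_ae hpos (by fun_prop), hint,
      ENNReal.toReal_ofReal (inv_pos.mpr hr).le]

theorem isProbabilityMeasure_twoParamExp (s : ℝ) {r : ℝ} (hr : 0 < r) :
    IsProbabilityMeasure (twoParamExp s r) :=
  have := isProbabilityMeasure_expMeasure hr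
  Measure.isProbabilityMeasure_map (by fun_prop)

theorem integrable_id_twoParamExp (s : ℝ) {r : ℝ} (hr : 0 < r) :
    Integrable (fun x : ℝ => x) (twoParamExp s r) ∧ ∫ x, x ∂twoParamExp s r = s + r⁻¹ := by
  have := isProbabilityMeasure_expMeasure hr
  obtain ⟨hi, hv⟩ := integrable_id_expMeasure hr
  refine ⟨?_, ?_⟩
  · rw [twoParamExp, integrable_map_measure (by fun_prop) (by fun_prop)]
    exact (integrable_const s).add hi
  · rw [twoParamExp, integral_map (by fun_prop) (by fun_prop),
      integral_add (integrable_const s) hi, hv]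
    simp

theorem ae_lt_twoParamExp (s : ℝ) {r : ℝ} (hr : 0 < r) : ∀ᵐ z ∂twoParamExp s r, s < z := by
  rw [twoParamExp, ae_map_iff (by fun_prop) measurableSet_Ioi]
  filter_upwards [ae_pos_expMeasure hr] with x hx
  linarith

theorem twoParamExp_Ioi (s : ℝ) {r : ℝ} (hr : 0 < r) {z : ℝ} (hz : s ≤ z) :
    twoParamExp s r (Set.Ioi z) = ENNReal.ofReal (Real.exp (-(r * (z - s)))) := by
  rw [twoParamExp, Measure.map_apply (by fun_prop) measurableSet_Ioi,
    ← expMeasure_Ioi hr (sub_nonneg.mpr hz)]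
  congr 1
  ext x
  simp [sub_lt_iff_lt_add']

end Tails

/-! ### Suprema over a finite index set -/

section FiniteSup

variable {X : Type*} [Finite X]

theorem le_iSup_of_finite (g : X → ℝ) (x : X) : g x ≤ ⨆ x, g x :=
  le_ciSup (Set.finite_range g).bddAbove x

theorem lt_iSup_iff_of_finite [Nonempty X] {g : X → ℝ} {c : ℝ} : c < ⨆ x, g x ↔ ∃ x, c < g x := by
  refine ⟨fun h => ?_, fun ⟨x, hx⟩ => hx.trans_le (le_iSup_of_finite g x)⟩
  obtain ⟨x, hx⟩ := exists_eq_ciSup_of_finite (f := g)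
  exact ⟨x, hx ▸ h⟩

theorem measurable_iSup_of_finite {Ω : Type*} [MeasurableSpace Ω] {g : X → Ω → ℝ}
    (hg : ∀ x, Measurable (g x)) : Measurable fun ω => ⨆ x, g x ω :=
  Measurable.iSup hg

theorem integrable_iSup_of_finite [Nonempty X] {Ω : Type*} [MeasurableSpace Ω] {P : Measure Ω}
    {g : X → Ω → ℝ} (hg : ∀ x, Measurable (g x)) (hi : ∀ x, Integrable (g x) P) :
    Integrable (fun ω => ⨆ x, g x ω) P := by
  have := Fintype.ofFinite X
  refine Integrable.mono' (integrable_finsetSum Finset.univ fun x _ => (hi x).abs)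
    (measurable_iSup_of_finite hg).aestronglyMeasurable (Filter.Eventually.of_forall fun ω => ?_)
  obtain ⟨x, hx⟩ := exists_eq_ciSup_of_finite (f := fun x => g x ω)
  rw [← hx, Real.norm_eq_abs]
  exact Finset.single_le_sum (f := fun x => |g x ω|) (fun _ _ => abs_nonneg _) (Finset.mem_univ x)

theorem continuous_iSup_of_finite [Nonempty X] {α : Type*} [TopologicalSpace α] {g : X → α → ℝ}
    (hg : ∀ x, Continuous (g x)) : Continuous fun z => ⨆ x, g x z := by
  have := Fintype.ofFinite X
  have h : (fun z => ⨆ x, g x z) = fun z => Finset.univ.sup' Finset.univ_nonempty fun x => g x z := by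
    ext z
    rw [Finset.sup'_univ_eq_ciSup]
  rw [h]
  exact Continuous.finset_sup'_apply _ fun x _ => hg x

end FiniteSup

/-! ### Domination of a Gaussian maximum by a randomized confidence bound -/

section RandomizedBound

/-- Comparison of expectations from a comparison of upper tails. -/
theorem integral_le_of_tail_le {Ω Ω' : Type*} [MeasurableSpace Ω] [MeasurableSpace Ω']
    {P : Measure Ω} {Q : Measure Ω'} [IsProbabilityMeasure P] [IsProbabilityMeasure Q]
    {M : Ω → ℝ} {H : Ω' → ℝ} (hM : Integrable M P) (hH : Integrable H Q) (b : ℝ)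
    (hb : ∀ᵐ z ∂Q, b ≤ H z) (h : ∀ u, 0 < u → P {ω | b + u < M ω} ≤ Q {z | b + u ≤ H z}) :
    ∫ ω, M ω ∂P ≤ ∫ z, H z ∂Q := by
  -- Truncating `M` below at `b` only increases its mean, and `H` already lies above `b`, so the
  -- layer-cake formula needs tails at levels above `b` only.
  have hM' : Integrable (fun ω => max (M ω - b) 0) P := (hM.sub (integrable_const b)).pos_part
  have hH' : Integrable (fun z => H z - b) Q := hH.sub (integrable_const b)
  have hH0 : 0 ≤ᵐ[Q] fun z => H z - b := hb.mono fun z hz => sub_nonneg.mpr hz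
  have hM0 : 0 ≤ᵐ[P] fun ω => max (M ω - b) 0 :=
    Filter.Eventually.of_forall fun ω => le_max_right _ _
  have key : ∫ ω, max (M ω - b) 0 ∂P ≤ ∫ z, (H z - b) ∂Q := by
    rw [integral_eq_lintegral_of_nonneg_ae hM0 hM'.1, integral_eq_lintegral_of_nonneg_ae hH0 hH'.1]
    refine ENNReal.toReal_mono ?_ ?_
    · exact ((hasFiniteIntegral_iff_ofReal hH0).1 hH'.2).ne
    rw [lintegral_eq_lintegral_meas_lt _ hM0 hM'.1.aemeasurable,
      lintegral_eq_lintegral_meas_le _ hH0 hH'.1.aemeasurable]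
    refine setLIntegral_mono' measurableSet_Ioi fun u hu => ?_
    have hu' : 0 < u := hu
    have h1 : {ω | u < max (M ω - b) 0} = {ω | b + u < M ω} := by
      ext ω
      simp only [Set.mem_ofPred_eq, lt_max_iff, hu'.not_gt, or_false]
      constructor <;> intro h <;> linarith
    have h2 : {z | u ≤ H z - b} = {z | b + u ≤ H z} := by
      ext z
      simp only [Set.mem_ofPred_eq]
      constructor <;> intro h <;> linarith
    rw [h1, h2]
    exact h u hu'
  have hle : ∫ ω, (M ω - b) ∂P ≤ ∫ ω, max (M ω - b) 0 ∂P :=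
    integral_mono (hM.sub (integrable_const b)) hM' fun ω => le_max_left _ _
  have := hle.trans key
  rw [integral_sub hM (integrable_const b), integral_sub hH (integrable_const b)] at this
  simpa using this

theorem integrable_sqrt_twoParamExp (s : ℝ) {r : ℝ} (hr : 0 < r) :
    Integrable (fun z : ℝ => √z) (twoParamExp s r) := by
  have := isProbabilityMeasure_twoParamExp s hr
  refine Integrable.mono' ((integrable_const (1 : ℝ)).add (integrable_id_twoParamExp s hr).1.abs)
    (by fun_prop) (Filter.Eventually.of_forall fun z => ?_)
  rw [Real.norm_eq_abs, abs_of_nonneg (Real.sqrt_nonneg z), Real.sqrt_le_iff]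
  have := le_abs_self z
  have := abs_nonneg z
  constructor
  · simp only [Pi.add_apply]; positivity
  · simp only [Pi.add_apply]; nlinarith

variable {X : Type*} [Fintype X] [Nonempty X]

theorem integrable_ucb_twoParamExp (s : ℝ) (m w : X → ℝ) :
    Integrable (fun z => ⨆ x, (m x + √z * √(w x))) (twoParamExp s (1 / 2)) := by
  have := isProbabilityMeasure_twoParamExp s (r := 1 / 2) (by norm_num)
  exact integrable_iSup_of_finite (fun x => by fun_prop) fun x =>
    (integrable_const _).add ((integrable_sqrt_twoParamExp s (by norm_num)).mul_const _)

/-- The expected maximum of finitely many Gaussian variables is at most the expected maximum of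
their upper confidence bounds with a suitable random confidence parameter. -/
theorem integral_iSup_le_integral_ucb (hX : 2 ≤ Fintype.card X) {Ω : Type*} [MeasurableSpace Ω]
    {P : Measure Ω} [IsProbabilityMeasure P] {s : ℝ}
    (hs : s = 2 * Real.log ((Fintype.card X : ℝ) / 2)) (m : X → ℝ) {w : X → ℝ} (hw : ∀ x, 0 ≤ w x)
    {R : X → Ω → ℝ} (hRm : ∀ x, Measurable (R x))
    (hR : ∀ x, P.map (R x) = gaussianReal 0 (w x).toNNReal) :
    ∫ ω, ⨆ x, (m x + R x ω) ∂P ≤ ∫ z, ⨆ x, (m x + √z * √(w x)) ∂twoParamExp s (1 / 2) := by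
  have := isProbabilityMeasure_twoParamExp s (r := 1 / 2) (by norm_num)
  have hX' : (2 : ℝ) ≤ Fintype.card X := by exact_mod_cast hX
  have hs0 : 0 ≤ s := by
    rw [hs]
    have := Real.log_nonneg (x := (Fintype.card X : ℝ) / 2) (by linarith)
    linarith
  set h : ℝ → ℝ := fun z => ⨆ x, (m x + √z * √(w x)) with hh
  have hmono : Monotone h := fun z z' hz =>
    ciSup_mono (Set.finite_range _).bddAbove fun x => by gcongr
  have hcont : Continuous h := continuous_iSup_of_finite fun x => by fun_prop
  have hMi : Integrable (fun ω => ⨆ x, (m x + R x ω)) P := by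
    refine integrable_iSup_of_finite (fun x => (hRm x).const_add _) fun x => ?_
    exact (integrable_const _).add
      (HasLaw.hasGaussianLaw ⟨(hRm x).aemeasurable, hR x⟩ : HasGaussianLaw (R x) P).integrable
  have htail : ∀ z, s ≤ z → P {ω | h z < ⨆ x, (m x + R x ω)} ≤
      ENNReal.ofReal (Real.exp (-(1 / 2 * (z - s)))) := by
    intro z hz
    have hsub : {ω | h z < ⨆ x, (m x + R x ω)} ⊆ ⋃ x, R x ⁻¹' Set.Ioi (√z * √(w x)) := by
      intro ω hω
      obtain ⟨x, hx⟩ := lt_iSup_iff_of_finite.1 hω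
      have := le_iSup_of_finite (fun x => m x + √z * √(w x)) x
      refine Set.mem_iUnion.2 ⟨x, ?_⟩
      simp only [Set.mem_preimage, Set.mem_Ioi]
      have hz' : m x + √z * √(w x) ≤ h z := this
      linarith
    calc P {ω | h z < ⨆ x, (m x + R x ω)}
        ≤ ∑ x, P (R x ⁻¹' Set.Ioi (√z * √(w x))) :=
          (measure_mono hsub).trans (measure_iUnion_fintype_le _ _)
      _ ≤ ∑ _x : X, ENNReal.ofReal (Real.exp (-z / 2) / 2) := by
          refine Finset.sum_le_sum fun x _ => ?_
          rw [← Measure.map_apply (hRm x) measurableSet_Ioi, hR]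
          have h := gaussianReal_Ioi_sqrt_le (w x).toNNReal (hs0.trans hz)
          rwa [Real.coe_toNNReal _ (hw x)] at h
      _ = ENNReal.ofReal (Real.exp (-(1 / 2 * (z - s)))) := by
          rw [Finset.sum_const, Finset.card_univ, nsmul_eq_mul, ← ENNReal.ofReal_natCast,
            ← ENNReal.ofReal_mul (by positivity)]
          congr 1
          -- Here the value of `s` enters: `exp (s / 2) = |X| / 2` absorbs the union bound.
          have hsp : -(1 / 2 * (z - s)) = Real.log ((Fintype.card X : ℝ) / 2) + -z / 2 := by
            rw [hs]; ring
          rw [hsp, Real.exp_add, Real.exp_log (by linarith)]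
          ring
  refine integral_le_of_tail_le hMi (integrable_ucb_twoParamExp s m w) (h s)
    ((ae_lt_twoParamExp s (by norm_num)).mono fun z hz => hmono hz.le) fun u hu => ?_
  -- If `h` reaches the level `h s + u`, continuity gives `z₀` with `h z₀` exactly at that level. By
  -- monotonicity `ζ > z₀` forces `h ζ ≥ h z₀`; the inequality need not be strict, since `h` may be
  -- flat, which is why the upper tail is taken with `≤`.
  by_cases hex : ∃ z₁, s ≤ z₁ ∧ h s + u ≤ h z₁
  · obtain ⟨z₁, hz₁, hz₁'⟩ := hex
    obtain ⟨z₀, hz₀, heq⟩ := intermediate_value_Icc hz₁ hcont.continuousOn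
      ⟨le_add_of_nonneg_right hu.le, hz₁'⟩
    rw [← heq]
    refine (htail z₀ hz₀.1).trans ?_
    rw [← twoParamExp_Ioi s (by norm_num) hz₀.1]
    exact measure_mono fun z hz => hmono (le_of_lt hz)
  -- If `h` stays below the level, the event lies in `{h z < M}` for every `z ≥ s`, so its
  -- probability is below an exponential tail that tends to `0`.
  · push Not at hex
    have hzero : P {ω | h s + u < ⨆ x, (m x + R x ω)} ≤ 0 := by
      have hlim : Filter.Tendsto (fun z : ℝ => ENNReal.ofReal (Real.exp (-(1 / 2 * (z - s)))))
          Filter.atTop (nhds 0) := by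
        rw [← ENNReal.ofReal_zero]
        refine ENNReal.tendsto_ofReal (Real.tendsto_exp_neg_atTop_nhds_zero.comp ?_)
        exact (Filter.tendsto_atTop_add_const_right _ (-s) Filter.tendsto_id).const_mul_atTop
          (by norm_num)
      refine ge_of_tendsto hlim ?_
      filter_upwards [Filter.eventually_ge_atTop s] with z hz
      exact (measure_mono fun ω hω => (hex z hz).trans hω).trans (htail z hz)
    exact hzero.trans zero_le

end RandomizedBound

/-! ### Determinants of noisy Gram matrices -/

section Gram

variable {X : Type*}

/-- The covariance matrix of the observations at `a₀, …, a_{t-1}`. -/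
noncomputable abbrev noisyGram (k : X → X → ℝ) (σ : ℝ) {t : ℕ} (a : Fin t → X) :
    Matrix (Fin t) (Fin t) ℝ :=
  kernelMatrix k a + σ ^ 2 • (1 : Matrix (Fin t) (Fin t) ℝ)

variable {k : X → X → ℝ} {σ : ℝ}

theorem noisyGram_posDef (hk : (Matrix.of k).PosSemidef) (hσ : 0 < σ) {t : ℕ} (a : Fin t → X) :
    (noisyGram k σ a).PosDef :=
  Matrix.PosDef.posSemidef_add (hk.submatrix a) (Matrix.PosDef.one.smul (by positivity))

theorem kernel_symm (hk : (Matrix.of k).PosSemidef) (x y : X) : k x y = k y x := by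
  simpa using hk.isHermitian.apply y x

theorem postVar_le (hk : (Matrix.of k).PosSemidef) (hσ : 0 < σ) {t : ℕ} (a : Fin t → X) (x : X) :
    postVar k σ a x ≤ k x x := by
  have h := (noisyGram_posDef hk hσ a).inv.posSemidef.dotProduct_mulVec_nonneg (kernelVec k a x)
  rw [star_trivial] at h
  rw [postVar]
  linarith

theorem inv_mul_noisyGram (hk : (Matrix.of k).PosSemidef) (hσ : 0 < σ) {t : ℕ} (a : Fin t → X) :
    (noisyGram k σ a)⁻¹ * noisyGram k σ a = 1 :=
  Matrix.nonsing_inv_mul _ (noisyGram_posDef hk hσ a).det_pos.ne'.isUnit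

/-- The Schur complement of the old block in the enlarged matrix is the posterior variance at the
new point plus `σ ^ 2`. -/
theorem det_noisyGram_succ (hk : (Matrix.of k).PosSemidef) (hσ : 0 < σ) {t : ℕ} (a : ℕ → X) :
    (noisyGram k σ fun i : Fin (t + 1) => a i).det =
      (noisyGram k σ fun i : Fin t => a i).det *
        (postVar k σ (fun i : Fin t => a i) (a t) + σ ^ 2) := by
  set S := noisyGram k σ fun i : Fin t => a i with hS
  let inv : Invertible S := Matrix.invertibleOfIsUnitDet S
    (noisyGram_posDef hk hσ _).det_pos.ne'.isUnit
  let c : Fin t → ℝ := kernelVec k (fun i : Fin t => a i) (a t)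
  have hblock : (noisyGram k σ fun i : Fin (t + 1) => a i) =
      (Matrix.fromBlocks S (Matrix.of fun i (_ : Fin 1) => c i) (Matrix.of fun (_ : Fin 1) i => c i)
        (Matrix.of fun (_ _ : Fin 1) => k (a t) (a t) + σ ^ 2)).submatrix
        finSumFinEquiv.symm finSumFinEquiv.symm := by
    rw [← Matrix.reindex_apply, ← Equiv.symm_apply_eq]
    ext i j
    rcases i with i | i <;> rcases j with j | j
    · simp [hS, kernelMatrix, Matrix.one_apply, Fin.ext_iff]
    · simp [kernelMatrix, c, kernelVec, Fin.ext_iff, kernel_symm hk (a i),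
        i.2.ne]
    · simp [kernelMatrix, c, kernelVec, Fin.ext_iff, j.2.ne']
    · simp [kernelMatrix, Matrix.one_apply, Fin.ext_iff]
  rw [hblock, Matrix.det_submatrix_equiv_self, Matrix.det_fromBlocks₁₁, Matrix.det_fin_one]
  congr 1
  rw [Matrix.invOf_eq_nonsing_inv, Matrix.mul_assoc]
  have : (Matrix.of (fun (_ : Fin 1) i => c i) * (S⁻¹ * Matrix.of fun i (_ : Fin 1) => c i)) 0 0 =
      c ⬝ᵥ (S⁻¹ *ᵥ c) := by
    simp [Matrix.mul_apply, dotProduct, Matrix.mulVec]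
  rw [Matrix.sub_apply, this, postVar]
  simp only [Matrix.of_apply]
  ring

theorem det_noisyGram_eq_prod (hk : (Matrix.of k).PosSemidef) (hσ : 0 < σ) (a : ℕ → X) (T : ℕ) :
    (noisyGram k σ fun i : Fin T => a i).det =
      ∏ t ∈ Finset.range T, (postVar k σ (fun i : Fin t => a i) (a t) + σ ^ 2) := by
  induction T with
  | zero => simp
  | succ T ih => rw [det_noisyGram_succ hk hσ, ih, Finset.prod_range_succ]

/-- By concavity the graph of the logarithm lies above its chord over `[1, 1 + c]`. -/
theorem log_one_add_mul_ge {c u : ℝ} (hc : 0 < c) (hu0 : 0 ≤ u) (hu1 : u ≤ 1) :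
    u * Real.log (1 + c) ≤ Real.log (1 + c * u) := by
  have h := strictConcaveOn_log_Ioi.concaveOn.2 (Set.mem_Ioi.2 one_pos)
    (Set.mem_Ioi.2 (by linarith : 0 < 1 + c)) (sub_nonneg.2 hu1) hu0 (by ring)
  simp only [smul_eq_mul, Real.log_one, mul_zero, zero_add] at h
  refine h.trans_eq ?_
  congr 1
  ring

/-- The information gained from observations at `a₀, …, a_{t-1}`. -/
noncomputable def gaussInfo (k : X → X → ℝ) (σ : ℝ) {t : ℕ} (a : Fin t → X) : ℝ :=
  (Real.log (noisyGram k σ a).det - t * Real.log (σ ^ 2)) / 2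

/-- The information is half the sum of `log (1 + postVar / σ ^ 2)` over the rounds. As each variance
lies in `[0, 1]`, the chord bound makes every summand at least `postVar * log (1 + (σ ^ 2)⁻¹)`. -/
theorem sum_postVar_le (hk : (Matrix.of k).PosSemidef) (hk1 : ∀ x, k x x = 1) (hσ : 0 < σ)
    (hv : ∀ (t : ℕ) (a : Fin t → X) (x : X), 0 ≤ postVar k σ a x) (a : ℕ → X) (T : ℕ) :
    ∑ t ∈ Finset.range T, postVar k σ (fun i : Fin t => a i) (a t) ≤
      2 / Real.log (1 + (σ ^ 2)⁻¹) * gaussInfo k σ fun i : Fin T => a i := by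
  have hσ2 : 0 < σ ^ 2 := by positivity
  have hL : 0 < Real.log (1 + (σ ^ 2)⁻¹) := Real.log_pos (by linarith [inv_pos.2 hσ2])
  rw [gaussInfo, det_noisyGram_eq_prod hk hσ, Real.log_prod fun t _ => by
    have := hv t (fun i => a i) (a t); positivity]
  have hterm : ∀ t, postVar k σ (fun i : Fin t => a i) (a t) * Real.log (1 + (σ ^ 2)⁻¹) ≤
      Real.log (postVar k σ (fun i : Fin t => a i) (a t) + σ ^ 2) - Real.log (σ ^ 2) := by
    intro t
    have h0 := hv t (fun i => a i) (a t)
    have h1 := (postVar_le hk hσ (fun i : Fin t => a i) (a t)).trans_eq (hk1 _)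
    rw [← Real.log_div (by positivity) hσ2.ne']
    convert log_one_add_mul_ge (inv_pos.2 hσ2) h0 h1 using 2
    field_simp
    ring
  have hsum := Finset.sum_le_sum fun t (_ : t ∈ Finset.range T) => hterm t
  rw [← Finset.sum_mul, Finset.sum_sub_distrib, Finset.sum_const, Finset.card_range,
    nsmul_eq_mul] at hsum
  rw [div_mul_div_comm, mul_comm (Real.log _) 2, mul_div_mul_left _ _ two_ne_zero, le_div_iff₀ hL]
  exact hsum

/-- Repeated points keep the rank at most `|X|`: with `B` the matrix selecting the queried points,
`det (1 + B * C) = det (1 + C * B)`, and the second determinant has size `|X|`. The Leibniz bound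
then makes the information logarithmic in `t`. -/
theorem gaussInfo_le [Fintype X] (hk : (Matrix.of k).PosSemidef) (hσ : 0 < σ) {M : ℝ}
    (hM : ∀ x y, |k x y| ≤ M) {t : ℕ} (a : Fin t → X) :
    gaussInfo k σ a ≤ (Real.log (Nat.factorial (Fintype.card X)) +
      Fintype.card X * Real.log (1 + (σ ^ 2)⁻¹ * M * t)) / 2 := by
  classical
  have hσ2 : 0 < σ ^ 2 := by positivity
  let B : Matrix (Fin t) X ℝ := Matrix.of fun i x => if a i = x then 1 else 0
  let C : Matrix X (Fin t) ℝ := Matrix.of fun x i => (σ ^ 2)⁻¹ * k x (a i)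
  have hS : noisyGram k σ a = σ ^ 2 • (1 + B * C) := by
    ext i j
    simp [kernelMatrix, B, C, Matrix.mul_apply, Matrix.one_apply]
    split_ifs <;> field_simp <;> ring
  have hdet : (noisyGram k σ a).det = (σ ^ 2) ^ t * (1 + C * B).det := by
    rw [hS, Matrix.det_smul, Fintype.card_fin, Matrix.det_one_add_mul_comm]
  have hpos := (noisyGram_posDef hk hσ a).det_pos
  have hpos' : 0 < (1 + C * B).det := by
    rw [hdet] at hpos
    exact pos_of_mul_pos_right hpos (by positivity)
  have hentry : ∀ x y, |(1 + C * B : Matrix X X ℝ) x y| ≤ 1 + (σ ^ 2)⁻¹ * M * t := by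
    intro x y
    have h1 : |(1 : Matrix X X ℝ) x y| ≤ 1 := by
      rw [Matrix.one_apply]; split_ifs <;> simp
    have h2 : |(C * B) x y| ≤ (σ ^ 2)⁻¹ * M * t := by
      rw [Matrix.mul_apply]
      refine (Finset.abs_sum_le_sum_abs _ _).trans ?_
      refine (Finset.sum_le_card_nsmul _ _ ((σ ^ 2)⁻¹ * M) fun i _ => ?_).trans_eq ?_
      · have hle : |(σ ^ 2)⁻¹ * k x (a i)| ≤ (σ ^ 2)⁻¹ * M := by
          rw [abs_mul, abs_of_pos (inv_pos.2 hσ2)]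
          exact mul_le_mul_of_nonneg_left (hM _ _) (inv_pos.2 hσ2).le
        simp only [B, C, Matrix.of_apply, mul_ite, mul_one, mul_zero]
        split_ifs
        · exact hle
        · simpa using (abs_nonneg _).trans hle
      · simp [mul_comm]
    exact (abs_add_le _ _).trans (add_le_add h1 h2)
  have hle := Matrix.det_le (abv := AbsoluteValue.abs) hentry
  rw [AbsoluteValue.abs_apply, abs_of_pos hpos', nsmul_eq_mul] at hle
  have hlog := Real.log_le_log hpos' hle
  have hbase : (1 + (σ ^ 2)⁻¹ * M * t) ^ Fintype.card X ≠ 0 := fun h0 => by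
    rw [h0, mul_zero] at hle
    exact absurd hle hpos'.not_ge
  rw [Real.log_mul (by positivity) hbase, Real.log_pow] at hlog
  rw [gaussInfo, hdet, Real.log_mul (by positivity) hpos'.ne', Real.log_pow]
  linarith

end Gram

/-! ### Maximum information gain and its sublinear growth -/

theorem tendsto_log_one_add_mul_div {c : ℝ} (hc : 0 < c) :
    Filter.Tendsto (fun n : ℕ => Real.log (1 + c * n) / n) Filter.atTop (nhds 0) := by
  -- Substitute `y = 1 + c * n`, so that `n = c⁻¹ * y - c⁻¹`.
  have h := (Real.tendsto_pow_log_div_mul_add_atTop c⁻¹ (-c⁻¹) 1 (inv_ne_zero hc.ne')).comp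
    (Filter.tendsto_atTop_add_const_left _ 1
      (tendsto_natCast_atTop_atTop.const_mul_atTop hc : Filter.Tendsto (fun n : ℕ => c * (n : ℝ))
        Filter.atTop Filter.atTop))
  refine h.congr fun n => ?_
  simp only [Function.comp_apply, pow_one]
  congr 1
  field_simp
  ring

section InfoGain

variable {Ω X : Type*} [MeasurableSpace Ω] {P : Measure Ω}
  {k : X → X → ℝ} {σ : ℝ} {f : X → Ω → ℝ} {ε : ℕ → Ω → ℝ}

theorem IsGPModel.memLp (h : IsGPModel P k σ f ε) (x : X) : MemLp (f x) 2 P :=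
  (h.gaussian_f.hasGaussianLaw_eval x).memLp_two

theorem IsGPModel.map_noise (h : IsGPModel P k σ f ε) (t : ℕ) :
    P.map (ε t) = gaussianReal 0 (σ ^ 2).toNNReal :=
  (h.law_noise t).map_eq

variable [Fintype X]

theorem IsGPModel.hasGaussianLaw_comp (h : IsGPModel P k σ f ε) {ι : Type*} [Fintype ι]
    (a : ι → X) : HasGaussianLaw (fun ω i => f (a i) ω) P :=
  (h.gaussian_f.hasGaussianLaw Finset.univ).map_fun
    (ContinuousLinearMap.pi fun i => ContinuousLinearMap.proj (⟨a i, Finset.mem_univ _⟩ :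
      {x // x ∈ (Finset.univ : Finset X)}))

variable [IsProbabilityMeasure P]

theorem IsGPModel.posSemidef (h : IsGPModel P k σ f ε) : (Matrix.of k).PosSemidef := by
  refine Matrix.PosSemidef.of_dotProduct_mulVec_nonneg ?_ fun c => ?_
  · ext x y
    simp [← h.cov_f, covariance_comm]
  · have hvar : star c ⬝ᵥ (Matrix.of k *ᵥ c) =
        covariance (fun ω => ∑ x, c x * f x ω) (fun ω => ∑ x, c x * f x ω) P := by
      rw [covariance_fun_sum_fun_sum (fun x => (h.memLp x).const_mul _)
        (fun x => (h.memLp x).const_mul _)]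
      simp only [covariance_const_mul_left, covariance_const_mul_right, h.cov_f, star_trivial,
        dotProduct, Matrix.mulVec, Matrix.of_apply, Finset.mul_sum]
      exact Finset.sum_congr rfl fun x _ => Finset.sum_congr rfl fun y _ => by ring
    rw [hvar, covariance_self]
    · exact variance_nonneg _ _
    · exact (Finset.measurable_sum _ fun x _ => (h.measurable_f x).const_mul _).aemeasurable

theorem IsGPModel.mutualInfo_eq (h : IsGPModel P k σ f ε) (hσ : 0 < σ) {t : ℕ} (a : Fin t → X) :
    mutualInfo P (fun ω (i : Fin t) => f (a i) ω + ε i ω) (fun ω (i : Fin t) => f (a i) ω) =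
      ENNReal.ofReal (gaussInfo k σ a) := by
  have hσ2 : 0 < σ ^ 2 := by positivity
  have hc : ((σ ^ 2).toNNReal : ℝ) = σ ^ 2 := Real.coe_toNNReal _ hσ2.le
  have hpd := noisyGram_posDef h.posSemidef hσ a
  rw [noisyGram, ← hc] at hpd
  have hind : IndepFun (fun ω (i : Fin t) => f (a i) ω) (fun ω (i : Fin t) => ε i ω) P :=
    h.indep_f_noise.comp (φ := fun (g : X → ℝ) (i : Fin t) => g (a i))
      (ψ := fun (e : ℕ → ℝ) (i : Fin t) => e i) (by fun_prop) (by fun_prop)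
  rw [mutualInfo_signal_noise (F := fun i => f (a i)) (e := fun i : Fin t => ε i)
    (v := (σ ^ 2).toNNReal) (h.hasGaussianLaw_comp a) (fun i => h.measurable_f _)
    (fun i => h.mean_f _) (Real.toNNReal_pos.2 hσ2).ne' (fun i => h.map_noise i)
    (fun i => h.measurable_noise i) (h.iIndep_noise.precomp Fin.val_injective) hind
    (K := kernelMatrix k a) (fun i j => h.cov_f _ _) hpd, hc, gaussInfo, Fintype.card_fin]

theorem IsGPModel.gaussInfo_le_maxInfoGain (h : IsGPModel P k σ f ε) (hσ : 0 < σ) {t : ℕ}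
    (a : Fin t → X) : gaussInfo k σ a ≤ (maxInfoGain P f ε t).toReal := by
  -- Finiteness has to be checked, as `toReal` sends `⊤` to `0`; the supremum is over finitely many
  -- tuples.
  have hfin : maxInfoGain P f ε t ≠ ⊤ := by
    rw [maxInfoGain]
    simp_rw [h.mutualInfo_eq hσ]
    refine ((Finite.bddAbove_range fun a : Fin t → X => gaussInfo k σ a).elim fun M hM => ?_)
    refine ne_top_of_le_ne_top (ENNReal.ofReal_ne_top (r := M)) (iSup_le fun b => ?_)
    exact ENNReal.ofReal_le_ofReal (hM ⟨b, rfl⟩)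
  refine (ENNReal.ofReal_le_iff_le_toReal hfin).1 ?_
  rw [← h.mutualInfo_eq hσ]
  exact le_iSup (fun b : Fin t → X => mutualInfo P (fun ω (i : Fin t) => f (b i) ω + ε i ω)
    (fun ω (i : Fin t) => f (b i) ω)) a

theorem IsGPModel.maxInfoGain_le (h : IsGPModel P k σ f ε) (hσ : 0 < σ) {M : ℝ}
    (hM : ∀ x y, |k x y| ≤ M) (hM0 : 0 ≤ M) (t : ℕ) :
    (maxInfoGain P f ε t).toReal ≤ (Real.log (Nat.factorial (Fintype.card X)) +
      Fintype.card X * Real.log (1 + (σ ^ 2)⁻¹ * M * t)) / 2 := by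
  have h1 : 0 ≤ Real.log (Nat.factorial (Fintype.card X)) :=
    Real.log_natCast_nonneg _
  have h2 : 0 ≤ Real.log (1 + (σ ^ 2)⁻¹ * M * t) := by
    refine Real.log_nonneg ?_
    have : 0 ≤ (σ ^ 2)⁻¹ * M * t := by positivity
    linarith
  refine ENNReal.toReal_le_of_le_ofReal (by positivity) ?_
  rw [maxInfoGain]
  refine iSup_le fun a => ?_
  rw [h.mutualInfo_eq hσ]
  exact ENNReal.ofReal_le_ofReal (gaussInfo_le h.posSemidef hσ hM a)

theorem IsGPModel.tendsto_maxInfoGain_div (h : IsGPModel P k σ f ε) (hσ : 0 < σ) :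
    Filter.Tendsto (fun n : ℕ => (maxInfoGain P f ε n).toReal / n) Filter.atTop (nhds 0) := by
  obtain ⟨M, hM⟩ := Finite.bddAbove_range fun p : X × X => |k p.1 p.2|
  have hM' : ∀ x y, |k x y| ≤ max M 1 := fun x y => (hM ⟨(x, y), rfl⟩).trans (le_max_left _ _)
  have hM1 : 0 < max M 1 := lt_max_of_lt_right one_pos
  have hc : 0 < (σ ^ 2)⁻¹ * max M 1 := by positivity
  have hlim : Filter.Tendsto (fun n : ℕ => Real.log (Nat.factorial (Fintype.card X)) / 2 / n +
      Fintype.card X / 2 * (Real.log (1 + (σ ^ 2)⁻¹ * max M 1 * n) / n)) Filter.atTop (nhds 0) := by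
    simpa using (tendsto_const_div_atTop_nhds_zero_nat _).add
      ((tendsto_log_one_add_mul_div hc).const_mul ((Fintype.card X : ℝ) / 2))
  refine squeeze_zero (fun n => by positivity) (fun n => ?_) hlim
  refine (div_le_div_of_nonneg_right (h.maxInfoGain_le hσ hM' hM1.le n)
    (Nat.cast_nonneg n)).trans_eq ?_
  ring

end InfoGain

/-! ### Independence and comparison of expectations -/

section Independence

variable {Ω α β γ : Type*} [MeasurableSpace Ω] [MeasurableSpace α] [MeasurableSpace β]
  [MeasurableSpace γ] {P : Measure Ω} [IsProbabilityMeasure P] {A : Ω → α} {B : Ω → β} {C : Ω → γ}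

theorem indepFun_prodMk_of_indepFun (hA : Measurable A) (hB : Measurable B) (hC : Measurable C)
    (hAB : IndepFun A B P) (hABC : IndepFun (fun ω => (A ω, B ω)) C P) :
    IndepFun A (fun ω => (B ω, C ω)) P := by
  have hBC : IndepFun B C P := hABC.comp measurable_snd measurable_id
  have : IsProbabilityMeasure (P.map A) := Measure.isProbabilityMeasure_map hA.aemeasurable
  have : IsProbabilityMeasure (P.map B) := Measure.isProbabilityMeasure_map hB.aemeasurable
  have : IsProbabilityMeasure (P.map C) := Measure.isProbabilityMeasure_map hC.aemeasurable
  rw [indepFun_iff_map_prod_eq_prod_map_map hA.aemeasurable (hB.prodMk hC).aemeasurable,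
    (indepFun_iff_map_prod_eq_prod_map_map hB.aemeasurable hC.aemeasurable).1 hBC,
    ← Measure.prodAssoc_prod,
    ← (indepFun_iff_map_prod_eq_prod_map_map hA.aemeasurable hB.aemeasurable).1 hAB,
    ← (indepFun_iff_map_prod_eq_prod_map_map (hA.prodMk hB).aemeasurable hC.aemeasurable).1 hABC,
    Measure.map_map MeasurableEquiv.prodAssoc.measurable ((hA.prodMk hB).prodMk hC)]
  rfl

/-- Expectations compare as soon as the conditional expectations given a common independent part
compare. -/
theorem integral_le_of_conditional {W : Ω → α} {R : Ω → β} {Z : Ω → γ} (hW : Measurable W)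
    (hR : Measurable R) (hZ : Measurable Z) (hWR : IndepFun W R P) (hWZ : IndepFun W Z P)
    {g : α × β → ℝ} {h : α × γ → ℝ} (hg : Measurable g) (hh : Measurable h)
    (hgi : Integrable (fun ω => g (W ω, R ω)) P) (hhi : Integrable (fun ω => h (W ω, Z ω)) P)
    (hle : ∀ w, ∫ r, g (w, r) ∂P.map R ≤ ∫ z, h (w, z) ∂P.map Z) :
    ∫ ω, g (W ω, R ω) ∂P ≤ ∫ ω, h (W ω, Z ω) ∂P := by
  have : IsProbabilityMeasure (P.map W) := Measure.isProbabilityMeasure_map hW.aemeasurable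
  have : IsProbabilityMeasure (P.map R) := Measure.isProbabilityMeasure_map hR.aemeasurable
  have : IsProbabilityMeasure (P.map Z) := Measure.isProbabilityMeasure_map hZ.aemeasurable
  have hgm := integral_map (μ := P) (hW.prodMk hR).aemeasurable hg.aestronglyMeasurable
  have hhm := integral_map (μ := P) (hW.prodMk hZ).aemeasurable hh.aestronglyMeasurable
  have hgi' := (integrable_map_measure (μ := P) hg.aestronglyMeasurable
    (hW.prodMk hR).aemeasurable).2 hgi
  have hhi' := (integrable_map_measure (μ := P) hh.aestronglyMeasurable
    (hW.prodMk hZ).aemeasurable).2 hhi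
  rw [(indepFun_iff_map_prod_eq_prod_map_map hW.aemeasurable hR.aemeasurable).1 hWR]
    at hgm hgi'
  rw [(indepFun_iff_map_prod_eq_prod_map_map hW.aemeasurable hZ.aemeasurable).1 hWZ]
    at hhm hhi'
  rw [← hgm, ← hhm, integral_prod _ hgi', integral_prod _ hhi']
  exact integral_mono hgi'.integral_prod_left hhi'.integral_prod_left hle

end Independence

/-! ### Residuals of Gaussian regression at fixed points -/

section Residual

variable {Ω X : Type*} {k : X → X → ℝ} {σ : ℝ} {f : X → Ω → ℝ} {ε : ℕ → Ω → ℝ} {t : ℕ}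
  {a : Fin t → X}

/-- The observations made at the fixed points `a₀, …, a_{t-1}`. -/
def fixedObs (f : X → Ω → ℝ) (ε : ℕ → Ω → ℝ) {t : ℕ} (a : Fin t → X) (ω : Ω) (i : Fin t) : ℝ :=
  f (a i) ω + ε i ω

/-- The part of `f(x)` that the observations at fixed points do not predict. -/
noncomputable def residual (k : X → X → ℝ) (σ : ℝ) (f : X → Ω → ℝ) (ε : ℕ → Ω → ℝ) {t : ℕ}
    (a : Fin t → X) (x : X) (ω : Ω) : ℝ :=
  f x ω - postMean k σ a (fixedObs f ε a ω) x

/-- The coefficients of the posterior mean. -/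
noncomputable def postCoeff (k : X → X → ℝ) (σ : ℝ) {t : ℕ} (a : Fin t → X) (x : X) : Fin t → ℝ :=
  kernelVec k a x ᵥ* (noisyGram k σ a)⁻¹

theorem postMean_eq_sum (y : Fin t → ℝ) (x : X) :
    postMean k σ a y x = ∑ i, postCoeff k σ a x i * y i := by
  rw [postMean, Matrix.dotProduct_mulVec]
  rfl

theorem postVar_eq_sum (x : X) :
    postVar k σ a x = k x x - ∑ i, postCoeff k σ a x i * k x (a i) := by
  rw [postVar, Matrix.dotProduct_mulVec]
  rfl

/-- The normal equations of linear prediction; they make the residual orthogonal to the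
observations. -/
theorem sum_postCoeff_mul_noisyGram (hk : (Matrix.of k).PosSemidef) (hσ : 0 < σ) (x : X)
    (j : Fin t) : ∑ i, postCoeff k σ a x i * noisyGram k σ a i j = k x (a j) := by
  change (postCoeff k σ a x ᵥ* noisyGram k σ a) j = _
  rw [postCoeff, Matrix.vecMul_vecMul, inv_mul_noisyGram hk hσ, Matrix.vecMul_one, kernelVec]

theorem residual_eq (x : X) : residual k σ f ε a x =
    fun ω => f x ω - ∑ i, postCoeff k σ a x i * (f (a i) ω + ε i ω) := by
  ext ω
  rw [residual, postMean_eq_sum]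
  rfl

@[fun_prop]
theorem measurable_postMean (x : X) : Measurable fun y : Fin t → ℝ => postMean k σ a y x := by
  simp_rw [postMean_eq_sum]
  fun_prop

variable [MeasurableSpace Ω] {P : Measure Ω}

theorem IsGPModel.measurable_fixedObs (h : IsGPModel P k σ f ε) : Measurable (fixedObs f ε a) :=
  measurable_pi_lambda _ fun _ => (h.measurable_f _).add (h.measurable_noise _)

theorem IsGPModel.measurable_residual (h : IsGPModel P k σ f ε) (x : X) :
    Measurable (residual k σ f ε a x) :=
  (h.measurable_f x).sub ((measurable_postMean x).comp h.measurable_fixedObs)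

theorem IsGPModel.memLp_noise (h : IsGPModel P k σ f ε) (i : ℕ) : MemLp (ε i) 2 P :=
  (h.law_noise i).hasGaussianLaw.memLp_two

theorem IsGPModel.integral_noise (h : IsGPModel P k σ f ε) (i : ℕ) : ∫ ω, ε i ω ∂P = 0 := by
  have h' := integral_map (μ := P) (f := fun x : ℝ => x) (h.measurable_noise i).aemeasurable
    (by fun_prop)
  rw [h.map_noise, integral_id_gaussianReal] at h'
  exact h'.symm

theorem IsGPModel.indepFun_comp (h : IsGPModel P k σ f ε) {ι : Type*} (b : ι → X) (t : ℕ) :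
    IndepFun (fun ω i => f (b i) ω) (fun ω (i : Fin t) => ε i ω) P :=
  h.indep_f_noise.comp (φ := fun (g : X → ℝ) i => g (b i))
    (ψ := fun (e : ℕ → ℝ) (i : Fin t) => e i) (by fun_prop) (by fun_prop)

theorem IsGPModel.covariance_f_fixedObs [IsProbabilityMeasure P] (h : IsGPModel P k σ f ε) (x y : X) (j : ℕ) :
    covariance (f x) (fun ω => f y ω + ε j ω) P = k x y := by
  have hind : IndepFun (f x) (ε j) P :=
    h.indep_f_noise.comp (measurable_pi_apply x) (measurable_pi_apply j)
  change covariance (f x) (f y + ε j) P = _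
  rw [covariance_add_right (h.memLp x) (h.memLp y) (h.memLp_noise j), h.cov_f,
    hind.covariance_eq_zero (h.memLp x) (h.memLp_noise j), add_zero]

theorem IsGPModel.integral_residual [IsProbabilityMeasure P] (h : IsGPModel P k σ f ε) (a : Fin t → X) (x : X) :
    ∫ ω, residual k σ f ε a x ω ∂P = 0 := by
  have hi : ∀ x, Integrable (f x) P := fun x => (h.memLp x).integrable (by norm_num)
  have he : ∀ i, Integrable (ε i) P := fun i => (h.memLp_noise i).integrable (by norm_num)
  simp_rw [residual_eq]
  have hY : ∀ i : Fin t, Integrable (fun ω => postCoeff k σ a x i * (f (a i) ω + ε i ω)) P :=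
    fun i => ((hi _).add (he _)).const_mul _
  rw [integral_sub (hi x) (integrable_finsetSum _ fun i _ => hY i),
    integral_finsetSum _ fun i _ => hY i, h.mean_f]
  simp [integral_const_mul, integral_add (hi _) (he _), h.mean_f, h.integral_noise]

variable [Fintype X]

theorem IsGPModel.hasGaussianLaw_residual (h : IsGPModel P k σ f ε) (a : Fin t → X) :
    HasGaussianLaw (fun ω => ((fun x => residual k σ f ε a x ω), fixedObs f ε a ω)) P := by
  have hjoint : HasGaussianLaw (fun ω => ((fun x => f x ω), fun i : Fin t => ε i ω)) P :=
    hasGaussianLaw_signal_noise (F := f) (e := fun i : Fin t => ε i)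
      (h.hasGaussianLaw_comp id) (fun i => h.map_noise i) (fun i => h.measurable_noise i)
      (h.iIndep_noise.precomp Fin.val_injective) (h.indepFun_comp id t)
  let L : (X → ℝ) × (Fin t → ℝ) →ₗ[ℝ] (X → ℝ) × (Fin t → ℝ) :=
    { toFun := fun z => ((fun x => z.1 x - ∑ i, postCoeff k σ a x i * (z.1 (a i) + z.2 i)),
        fun i => z.1 (a i) + z.2 i)
      map_add' := fun z w => by
        refine Prod.ext (funext fun x => ?_) (funext fun i => ?_)
        · simp only [Prod.fst_add, Prod.snd_add, Pi.add_apply, mul_add, Finset.sum_add_distrib]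
          ring
        · simp only [Prod.fst_add, Prod.snd_add, Pi.add_apply]
          ring
      map_smul' := fun c z => by
        refine Prod.ext (funext fun x => ?_) (funext fun i => ?_)
        · simp only [Prod.smul_fst, Prod.smul_snd, Pi.smul_apply, smul_eq_mul, RingHom.id_apply,
            mul_sub, Finset.mul_sum]
          congr 1
          exact Finset.sum_congr rfl fun i _ => by ring
        · simp only [Prod.smul_fst, Prod.smul_snd, Pi.smul_apply, smul_eq_mul, RingHom.id_apply]
          ring }
  have := hjoint.map_fun L.toContinuousLinearMap
  simp_rw [residual_eq]
  exact this

theorem IsGPModel.memLp_residual (h : IsGPModel P k σ f ε) (a : Fin t → X) (x : X) :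
    MemLp (residual k σ f ε a x) 2 P :=
  ((h.hasGaussianLaw_residual a).fst.eval x).memLp_two

variable [IsProbabilityMeasure P]

theorem IsGPModel.covariance_fixedObs (h : IsGPModel P k σ f ε) (a : Fin t → X) (i j : Fin t) :
    covariance (fun ω => f (a i) ω + ε i ω) (fun ω => f (a j) ω + ε j ω) P =
      noisyGram k σ a i j := by
  have := covariance_signal_noise (F := fun i => f (a i)) (e := fun i : Fin t => ε i)
    (h.hasGaussianLaw_comp a) (fun i => h.map_noise i) (fun i => h.measurable_noise i)
    (h.iIndep_noise.precomp Fin.val_injective) (h.indepFun_comp a t)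
    (K := kernelMatrix k a) (fun i j => h.cov_f _ _) i j
  rwa [Real.coe_toNNReal _ (sq_nonneg σ)] at this

theorem IsGPModel.covariance_residual (h : IsGPModel P k σ f ε) (hσ : 0 < σ) (a : Fin t → X)
    (x : X) (j : Fin t) :
    covariance (residual k σ f ε a x) (fun ω => f (a j) ω + ε j ω) P = 0 := by
  have hY : ∀ i : Fin t, MemLp (fun ω => f (a i) ω + ε i ω) 2 P := fun i =>
    (h.memLp _).add (h.memLp_noise _)
  rw [residual_eq, covariance_fun_sub_left (h.memLp x)
    (memLp_finsetSum _ fun i _ => (hY i).const_mul _) (hY j),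
    covariance_fun_sum_left (fun i => (hY i).const_mul _) (hY j), h.covariance_f_fixedObs]
  simp_rw [covariance_const_mul_left, h.covariance_fixedObs]
  rw [sum_postCoeff_mul_noisyGram h.posSemidef hσ, sub_self]

theorem IsGPModel.variance_residual (h : IsGPModel P k σ f ε) (hσ : 0 < σ) (a : Fin t → X)
    (x : X) : covariance (residual k σ f ε a x) (residual k σ f ε a x) P = postVar k σ a x := by
  have hY : ∀ i : Fin t, MemLp (fun ω => f (a i) ω + ε i ω) 2 P := fun i =>
    (h.memLp _).add (h.memLp_noise _)
  have hsum : MemLp (fun ω => ∑ i, postCoeff k σ a x i * (f (a i) ω + ε i ω)) 2 P :=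
    memLp_finsetSum _ fun i _ => (hY i).const_mul _
  have hR := h.memLp_residual a x
  have h1 : covariance (residual k σ f ε a x)
      (fun ω => ∑ i, postCoeff k σ a x i * (f (a i) ω + ε i ω)) P = 0 := by
    rw [covariance_fun_sum_right (fun i => (hY i).const_mul _) hR]
    simp_rw [covariance_const_mul_right, h.covariance_residual hσ]
    simp
  have h2 : covariance (residual k σ f ε a x) (f x) P = postVar k σ a x := by
    rw [residual_eq, covariance_fun_sub_left (h.memLp x) hsum (h.memLp x),
      covariance_fun_sum_left (fun i => (hY i).const_mul _) (h.memLp x), h.cov_f, postVar_eq_sum]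
    simp_rw [covariance_const_mul_left, covariance_comm _ (f x), h.covariance_f_fixedObs]
  calc covariance (residual k σ f ε a x) (residual k σ f ε a x) P
      = covariance (residual k σ f ε a x)
          (fun ω => f x ω - ∑ i, postCoeff k σ a x i * (f (a i) ω + ε i ω)) P :=
        congrArg (covariance (residual k σ f ε a x) · P) (residual_eq x)
    _ = postVar k σ a x := by
        rw [covariance_fun_sub_right hR (h.memLp x) hsum, h1, h2, sub_zero]

theorem IsGPModel.postVar_nonneg (h : IsGPModel P k σ f ε) (hσ : 0 < σ) (a : Fin t → X) (x : X) :
    0 ≤ postVar k σ a x := by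
  rw [← h.variance_residual hσ, covariance_self (h.measurable_residual x).aemeasurable]
  exact variance_nonneg _ _

theorem IsGPModel.map_residual (h : IsGPModel P k σ f ε) (hσ : 0 < σ) (a : Fin t → X) (x : X) :
    P.map (residual k σ f ε a x) = gaussianReal 0 (postVar k σ a x).toNNReal :=
  law_eq_gaussianReal ((h.hasGaussianLaw_residual a).fst.eval x) (h.integral_residual a x)
    (h.variance_residual hσ a x)

/-- Residuals and observations are jointly Gaussian, so vanishing cross-covariances give
independence. -/
theorem IsGPModel.indepFun_residual (h : IsGPModel P k σ f ε) (hσ : 0 < σ) (a : Fin t → X) :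
    IndepFun (fun ω x => residual k σ f ε a x ω) (fixedObs f ε a) P :=
  (h.hasGaussianLaw_residual a).indepFun_of_covariance_eval fun x j =>
    h.covariance_residual hσ a x j

end Residual

/-! ### Evaluation at a random point of a finite set -/

section Selection

variable {Ω X : Type*} [MeasurableSpace Ω] [Fintype X] [MeasurableSpace X]
  [MeasurableSingletonClass X] {P : Measure Ω}

theorem measurable_select {g : X → Ω → ℝ} (hg : ∀ b, Measurable (g b)) {x : Ω → X}
    (hx : Measurable x) : Measurable fun ω => g (x ω) ω :=
  (measurable_from_prod_countable_left (f := fun p : Ω × X => g p.2 p.1) hg).comp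
    (measurable_id.prodMk hx)

theorem integrable_select {g : X → Ω → ℝ} (hg : ∀ b, Measurable (g b))
    (hi : ∀ b, Integrable (g b) P) {x : Ω → X} (hx : Measurable x) :
    Integrable (fun ω => g (x ω) ω) P := by
  refine Integrable.mono' (integrable_finsetSum Finset.univ fun b _ => (hi b).abs)
    (measurable_select hg hx).aestronglyMeasurable (Filter.Eventually.of_forall fun ω => ?_)
  exact Finset.single_le_sum (f := fun b => |g b ω|) (fun _ _ => abs_nonneg _)
    (Finset.mem_univ (x ω))

/-- Expectations can be split according to the value of a random element of a finite set. -/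
theorem integral_eq_sum_fibers {g : Ω → ℝ} (hi : Integrable g P) {x : Ω → X} (hx : Measurable x) :
    ∫ ω, g ω ∂P = ∑ b, ∫ ω in x ⁻¹' {b}, g ω ∂P := by
  classical
  have hms : ∀ b, MeasurableSet (x ⁻¹' {b}) := fun b => hx (measurableSet_singleton b)
  simp_rw [← integral_indicator (hms _)]
  rw [← integral_finsetSum _ fun b _ => hi.indicator (hms b)]
  refine integral_congr_ae (Filter.Eventually.of_forall fun ω => ?_)
  simp [Set.indicator_apply]

end Selection

/-! ### Query paths and what determines them -/

section Algorithm

/-- Along a fixed sequence of points, the history is a function of the observations made at these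
points and of the internal randomness. -/
theorem history_eq {Ω X 𝒰 : Type*} {f : X → Ω → ℝ} {ε ζ : ℕ → Ω → ℝ} {U : Ω → 𝒰}
    {x : ℕ → Ω → X} {a : ℕ → X} {t : ℕ} {ω : Ω} (hω : ∀ i < t, x i ω = a i) :
    history f ε ζ U x t ω = (U ω, (fun i : Fin (t + 1) => ζ i ω), (fun i : Fin t => a i),
      fixedObs f ε (fun i : Fin t => a i) ω) := by
  have h1 : (fun i : Fin t => x i ω) = fun i : Fin t => a i := funext fun i => hω i i.2
  have h2 : (fun i : Fin t => obs f ε x i ω) = fixedObs f ε (fun i : Fin t => a i) ω :=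
    funext fun i => by rw [obs, hω i i.2, fixedObs]
  rw [history, h1, h2]

variable {Ω X 𝒰 : Type*} [MeasurableSpace Ω] [MeasurableSpace 𝒰] {P : Measure Ω}
  {k : X → X → ℝ} {σ s lam : ℝ} {f : X → Ω → ℝ} {ε ζ : ℕ → Ω → ℝ} {U : Ω → 𝒰} {x : ℕ → Ω → X}

/-- The internal randomness of the first `t` queries. -/
def seed (ζ : ℕ → Ω → ℝ) (U : Ω → 𝒰) (t : ℕ) (ω : Ω) : 𝒰 × (Fin t → ℝ) :=
  (U ω, fun i => ζ i ω)

variable [MeasurableSpace X]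

theorem IsIRGPUCB.measurable_seed (h : IsIRGPUCB P k σ s lam f ε ζ U x) (t : ℕ) :
    Measurable (seed ζ U t) :=
  h.measurable_U.prodMk (measurable_pi_lambda _ fun _ => h.measurable_zeta _)

theorem IsIRGPUCB.map_zeta (h : IsIRGPUCB P k σ s lam f ε ζ U x) (t : ℕ) :
    P.map (ζ t) = twoParamExp s lam :=
  (h.law_zeta t).map_eq

/-- The length `n` of the seed is free because two values are needed: `n = t` when `ζ t` is
integrated separately, and `n = t + 1` when the query `x t`, which depends on `ζ t`, is fixed. -/
theorem IsIRGPUCB.indepFun_residual [Fintype X] [IsProbabilityMeasure P] (hm : IsGPModel P k σ f ε)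
    (h : IsIRGPUCB P k σ s lam f ε ζ U x) (hσ : 0 < σ) {t : ℕ} (a : Fin t → X) (n : ℕ) :
    IndepFun (fun ω => (seed ζ U n ω, fixedObs f ε a ω))
      (fun ω b => residual k σ f ε a b ω) P := by
  have hRm : Measurable fun ω b => residual k σ f ε a b ω :=
    measurable_pi_lambda _ fun b => hm.measurable_residual b
  have hind : IndepFun (fun ω => ((fun b => residual k σ f ε a b ω), fixedObs f ε a ω))
      (seed ζ U n) P := by
    have hobs : Measurable fun p : (X → ℝ) × (ℕ → ℝ) => fun i : Fin t => p.1 (a i) + p.2 i := by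
      fun_prop
    have h1 : Measurable fun p : (X → ℝ) × (ℕ → ℝ) =>
        ((fun b => p.1 b - postMean k σ a (fun i : Fin t => p.1 (a i) + p.2 i) b),
          fun i : Fin t => p.1 (a i) + p.2 i) :=
      (measurable_pi_lambda _ fun b => (by fun_prop : Measurable fun p : (X → ℝ) × (ℕ → ℝ) =>
        p.1 b).sub ((measurable_postMean b).comp hobs)).prodMk hobs
    have h2 : Measurable fun p : (ℕ → ℝ) × 𝒰 => (p.2, fun i : Fin n => p.1 i) := by fun_prop
    exact h.indep_env.comp h1 h2
  exact ((indepFun_prodMk_of_indepFun hRm hm.measurable_fixedObs (h.measurable_seed n)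
    (hm.indepFun_residual hσ a) hind).comp measurable_id measurable_swap).symm

/-- The fresh parameter is independent of the earlier ones, then of `U`, then of the environment;
`indepFun_prodMk_of_indepFun` adds these one at a time. -/
theorem IsIRGPUCB.indepFun_zeta [IsProbabilityMeasure P] (hm : IsGPModel P k σ f ε)
    (h : IsIRGPUCB P k σ s lam f ε ζ U x) {t : ℕ} (a : Fin t → X) :
    IndepFun (fun ω => (seed ζ U t ω, fixedObs f ε a ω)) (ζ t) P := by
  have hpast : Measurable fun ω => fun i : Fin t => ζ i ω :=
    measurable_pi_lambda _ fun _ => h.measurable_zeta _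
  have h1 : IndepFun (ζ t) (fun ω (i : Fin t) => ζ i ω) P :=
    (h.iIndep_zeta.indepFun_finset {t} (Finset.range t) (by simp) h.measurable_zeta).comp
      (φ := fun g : ({t} : Finset ℕ) → ℝ => g ⟨t, Finset.mem_singleton_self t⟩)
      (ψ := fun (g : Finset.range t → ℝ) (i : Fin t) => g ⟨i, Finset.mem_range.2 i.2⟩)
      (by fun_prop) (by fun_prop)
  have h2 : IndepFun (fun ω => (ζ t ω, fun i : Fin t => ζ i ω)) U P :=
    h.indep_zeta_U.comp (φ := fun z : ℕ → ℝ => (z t, fun i : Fin t => z i)) (ψ := id)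
      (by fun_prop) measurable_id
  have h3 : IndepFun (ζ t) (seed ζ U t) P :=
    (indepFun_prodMk_of_indepFun (h.measurable_zeta t) hpast h.measurable_U h1 h2).comp
      measurable_id measurable_swap
  have h4 : IndepFun (fun ω => (ζ t ω, seed ζ U t ω)) (fixedObs f ε a) P :=
    (h.indep_env.comp (φ := fun p : (X → ℝ) × (ℕ → ℝ) => fun i : Fin t => p.1 (a i) + p.2 i)
      (ψ := fun p : (ℕ → ℝ) × 𝒰 => (p.1 t, p.2, fun i : Fin t => p.1 i))
      (by fun_prop) (by fun_prop)).symm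
  exact (indepFun_prodMk_of_indepFun (h.measurable_zeta t) (h.measurable_seed t)
    hm.measurable_fixedObs h3 h4).symm

variable [MeasurableSingletonClass X]

/-- Non-anticipation makes `x t = b` an event of the history, and along the path the random points
and observations in the history are those at the fixed `a`. -/
theorem IsIRGPUCB.exists_query_set (h : IsIRGPUCB P k σ s lam f ε ζ U x) (a : ℕ → X) (t : ℕ)
    (b : X) : ∃ S : Set ((𝒰 × (Fin (t + 1) → ℝ)) × (Fin t → ℝ)), MeasurableSet S ∧
      ∀ ω, (∀ i < t, x i ω = a i) →
        (x t ω = b ↔ (seed ζ U (t + 1) ω, fixedObs f ε (fun i : Fin t => a i) ω) ∈ S) := by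
  obtain ⟨Q, hQ, hQx⟩ := h.nonanticipating t (measurableSet_singleton b)
  refine ⟨(fun p => (p.1.1, p.1.2, (fun i : Fin t => a i), p.2)) ⁻¹' Q, ?_, fun ω hω => ?_⟩
  · have hmeas : Measurable fun p : (𝒰 × (Fin (t + 1) → ℝ)) × (Fin t → ℝ) =>
        (p.1.1, p.1.2, (fun i : Fin t => a i), p.2) := by fun_prop
    exact hmeas hQ
  · have h1 : x t ω = b ↔ ω ∈ history f ε ζ U x t ⁻¹' Q := by
      rw [hQx]
      simp
    rw [h1, Set.mem_preimage, history_eq hω]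
    rfl

/-- Whether the algorithm follows a given sequence of points is decided by the observations made at
these points and by the internal randomness. -/
theorem IsIRGPUCB.exists_path_set (h : IsIRGPUCB P k σ s lam f ε ζ U x) (a : ℕ → X) (t : ℕ) :
    ∃ S : Set ((𝒰 × (Fin t → ℝ)) × (Fin t → ℝ)), MeasurableSet S ∧
      ∀ ω, (∀ i < t, x i ω = a i) ↔
        (seed ζ U t ω, fixedObs f ε (fun i : Fin t => a i) ω) ∈ S := by
  induction t with
  | zero => exact ⟨Set.univ, MeasurableSet.univ, fun ω => by simp⟩
  | succ t ih =>
    obtain ⟨S, hS, hSx⟩ := ih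
    obtain ⟨S', hS', hSx'⟩ := h.exists_query_set a t (a t)
    refine ⟨(fun p => ((p.1.1, fun i : Fin t => p.1.2 i.castSucc), fun i : Fin t => p.2 i.castSucc))
        ⁻¹' S ∩ (fun p => (p.1, fun i : Fin t => p.2 i.castSucc)) ⁻¹' S', ?_, fun ω => ?_⟩
    · refine MeasurableSet.inter ?_ ?_
      · have hmeas : Measurable fun p : (𝒰 × (Fin (t + 1) → ℝ)) × (Fin (t + 1) → ℝ) =>
            ((p.1.1, fun i : Fin t => p.1.2 i.castSucc), fun i : Fin t => p.2 i.castSucc) := by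
          fun_prop
        exact hmeas hS
      · have hmeas : Measurable fun p : (𝒰 × (Fin (t + 1) → ℝ)) × (Fin (t + 1) → ℝ) =>
            (p.1, fun i : Fin t => p.2 i.castSucc) := by
          fun_prop
        exact hmeas hS'
    · rw [Nat.forall_lt_succ_right]
      constructor
      · rintro ⟨h1, h2⟩
        exact ⟨(hSx ω).1 h1, (hSx' ω h1).1 h2⟩
      · rintro ⟨h1, h2⟩
        have h1' := (hSx ω).2 h1
        exact ⟨h1', (hSx' ω h1').2 h2⟩

variable [Fintype X]

/-- Strong induction: once the earlier queries are measurable, so is the history, and the query is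
measurable with respect to it. -/
theorem IsIRGPUCB.measurable_query (hm : IsGPModel P k σ f ε)
    (h : IsIRGPUCB P k σ s lam f ε ζ U x) (t : ℕ) : Measurable (x t) := by
  induction t using Nat.strong_induction_on with
  | _ t ih =>
    have hhist : Measurable (history f ε ζ U x t) := by
      have h1 : Measurable fun ω (i : Fin t) => x i ω := measurable_pi_lambda _ fun i => ih i i.2
      have h2 : Measurable fun ω (i : Fin t) => obs f ε x i ω := measurable_pi_lambda _ fun i =>
        (measurable_select hm.measurable_f (ih i i.2)).add (hm.measurable_noise i)
      exact (h.measurable_seed (t + 1)).fst.prodMk ((h.measurable_seed (t + 1)).snd.prodMk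
        (h1.prodMk h2))
    exact (h.nonanticipating t).mono hhist.comap_le le_rfl

variable [IsProbabilityMeasure P]

/-- The residuals at the chosen point have mean zero on each path. -/
theorem IsIRGPUCB.setIntegral_residual (hm : IsGPModel P k σ f ε)
    (h : IsIRGPUCB P k σ s lam f ε ζ U x) (hσ : 0 < σ) (a : ℕ → X) (t : ℕ) :
    ∫ ω in {ω | ∀ i < t, x i ω = a i}, residual k σ f ε (fun i : Fin t => a i) (x t ω) ω ∂P = 0 := by
  have hx := h.measurable_query hm
  have hE : MeasurableSet {ω | ∀ i < t, x i ω = a i} := by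
    have : {ω | ∀ i < t, x i ω = a i} = ⋂ i : Fin t, x i ⁻¹' {a i} := by
      ext ω
      simp [Fin.forall_iff]
    rw [this]
    exact MeasurableSet.iInter fun i => hx i (measurableSet_singleton _)
  set R := residual k σ f ε (fun i : Fin t => a i) with hR
  have hRi : ∀ b, Integrable (R b) P := fun b => (hm.memLp_residual _ b).integrable (by norm_num)
  rw [integral_eq_sum_fibers (integrable_select (fun b => hm.measurable_residual b) hRi
    (hx t)).integrableOn (hx t)]
  refine Finset.sum_eq_zero fun b _ => ?_
  rw [Measure.restrict_restrict (hx t (measurableSet_singleton b))]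
  obtain ⟨S, hS, hSx⟩ := h.exists_path_set a t
  obtain ⟨S', hS', hSx'⟩ := h.exists_query_set a t b
  -- The seed includes `ζ t`, so `W` decides both the path and the query `x t`, while still being
  -- independent of the residual.
  let W : Ω → (𝒰 × (Fin (t + 1) → ℝ)) × (Fin t → ℝ) := fun ω =>
    (seed ζ U (t + 1) ω, fixedObs f ε (fun i : Fin t => a i) ω)
  let S'' : Set ((𝒰 × (Fin (t + 1) → ℝ)) × (Fin t → ℝ)) :=
    (fun p => ((p.1.1, fun i : Fin t => p.1.2 i.castSucc), p.2)) ⁻¹' S ∩ S'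
  have hS'' : MeasurableSet S'' := by
    refine MeasurableSet.inter ?_ hS'
    have hmeas : Measurable fun p : (𝒰 × (Fin (t + 1) → ℝ)) × (Fin t → ℝ) =>
        ((p.1.1, fun i : Fin t => p.1.2 i.castSucc), p.2) := by fun_prop
    exact hmeas hS
  have hset : x t ⁻¹' {b} ∩ {ω | ∀ i < t, x i ω = a i} = W ⁻¹' S'' := by
    ext ω
    constructor
    · rintro ⟨h1, h2⟩
      exact ⟨(hSx ω).1 h2, (hSx' ω h2).1 h1⟩
    · rintro ⟨h1, h2⟩
      have h1' := (hSx ω).2 h1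
      exact ⟨(hSx' ω h1').2 h2, h1'⟩
  have hWm : Measurable W := (h.measurable_seed _).prodMk hm.measurable_fixedObs
  have hcongr : ∫ ω in x t ⁻¹' {b} ∩ {ω | ∀ i < t, x i ω = a i}, R (x t ω) ω ∂P =
      ∫ ω in W ⁻¹' S'', R b ω ∂P := by
    rw [← hset]
    refine setIntegral_congr_fun ((hx t (measurableSet_singleton b)).inter hE) fun ω hω => ?_
    have : x t ω = b := hω.1
    simp only [this]
  rw [hcongr, ← integral_indicator (hWm hS'')]
  have hmul : ∀ ω, (W ⁻¹' S'').indicator (R b) ω = S''.indicator (fun _ => (1 : ℝ)) (W ω) * R b ω := by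
    intro ω
    by_cases hω : W ω ∈ S'' <;> simp [hω]
  simp_rw [hmul]
  have hind : IndepFun (fun ω => S''.indicator (fun _ => (1 : ℝ)) (W ω)) (R b) P :=
    (h.indepFun_residual hm hσ (fun i : Fin t => a i) (t + 1)).comp
      (measurable_const.indicator hS'') (measurable_pi_apply b)
  rw [hind.integral_fun_mul_eq_mul_integral
    ((measurable_const.indicator hS'').comp hWm).aestronglyMeasurable (hRi b).1,
    hm.integral_residual, mul_zero]

end Algorithm

/-! ### From confidence bounds to Bayesian simple regret -/

section Regret

variable {Ω X 𝒰 : Type*} [MeasurableSpace Ω] [MeasurableSpace 𝒰] {P : Measure Ω} [MeasurableSpace X]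
  {k : X → X → ℝ} {σ s : ℝ} {f : X → Ω → ℝ} {ε ζ : ℕ → Ω → ℝ} {U : Ω → 𝒰} {x : ℕ → Ω → X}

theorem IsIRGPUCB.integrable_sqrt_zeta (h : IsIRGPUCB P k σ s (1 / 2) f ε ζ U x) (t : ℕ) :
    Integrable (fun ω => √(ζ t ω)) P := by
  have hi := integrable_sqrt_twoParamExp s (r := 1 / 2) (by norm_num)
  rw [← h.map_zeta t] at hi
  exact hi.comp_measurable (h.measurable_zeta t)

theorem IsIRGPUCB.integrable_zeta (h : IsIRGPUCB P k σ s (1 / 2) f ε ζ U x) (t : ℕ) :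
    Integrable (ζ t) P ∧ ∫ ω, ζ t ω ∂P = 2 + s := by
  obtain ⟨hi, hv⟩ := integrable_id_twoParamExp s (r := 1 / 2) (by norm_num)
  have hmap := integral_map (μ := P) (f := fun z : ℝ => z) (h.measurable_zeta t).aemeasurable
    (by fun_prop)
  rw [h.map_zeta t, hv] at hmap
  rw [← h.map_zeta t] at hi
  refine ⟨hi.comp_measurable (h.measurable_zeta t), hmap.symm.trans ?_⟩
  norm_num
  ring

variable [IsProbabilityMeasure P] [Fintype X] [Nonempty X] [MeasurableSingletonClass X]

/-- On each path, the maximum of `f` is dominated in expectation by the upper confidence bound at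
the chosen point. -/
theorem IsIRGPUCB.setIntegral_iSup_le (hm : IsGPModel P k σ f ε)
    (h : IsIRGPUCB P k σ s (1 / 2) f ε ζ U x) (hσ : 0 < σ) (hX : 2 ≤ Fintype.card X)
    (hs : s = 2 * Real.log ((Fintype.card X : ℝ) / 2)) (a : ℕ → X) (t : ℕ) :
    ∫ ω in {ω | ∀ i < t, x i ω = a i}, ⨆ b, f b ω ∂P ≤
      ∫ ω in {ω | ∀ i < t, x i ω = a i},
        (f (x t ω) ω + √(ζ t ω) * √(postVar k σ (fun i : Fin t => a i) (x t ω))) ∂P := by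
  have hx := h.measurable_query hm
  have hfi : ∀ b, Integrable (f b) P := fun b => (hm.memLp b).integrable (by norm_num)
  set a' : Fin t → X := fun i => a i with ha'
  set R := residual k σ f ε a' with hR
  set v := postVar k σ a' with hv
  have hRm : ∀ b, Measurable (R b) := fun b => hm.measurable_residual b
  have hRi : ∀ b, Integrable (R b) P := fun b => (hm.memLp_residual _ b).integrable (by norm_num)
  have hRvm : Measurable fun ω b => R b ω := measurable_pi_lambda _ hRm
  let m : X → Ω → ℝ := fun b ω => postMean k σ a' (fixedObs f ε a' ω) b
  have hmm : ∀ b, Measurable (m b) := fun b => (measurable_postMean b).comp hm.measurable_fixedObs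
  have hfm : ∀ b ω, m b ω + R b ω = f b ω := fun b ω => add_sub_cancel _ _
  have hmi : ∀ b, Integrable (m b) P := fun b =>
    ((hfi b).sub (hRi b)).congr (Filter.Eventually.of_forall fun ω => by
      rw [Pi.sub_apply, ← hfm b ω, add_sub_cancel_right])
  obtain ⟨S, hS, hSx⟩ := h.exists_path_set a t
  let W : Ω → (𝒰 × (Fin t → ℝ)) × (Fin t → ℝ) := fun ω => (seed ζ U t ω, fixedObs f ε a' ω)
  have hWm : Measurable W := (h.measurable_seed t).prodMk hm.measurable_fixedObs
  have hE : {ω | ∀ i < t, x i ω = a i} = W ⁻¹' S := Set.ext hSx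
  have hEm : MeasurableSet {ω | ∀ i < t, x i ω = a i} := hE ▸ hWm hS
  -- The path event enters as an indicator depending on `W` alone. For `W` frozen, `g` and `u` are
  -- then the two sides of `integral_iSup_le_integral_ucb`, or both vanish.
  let g : ((𝒰 × (Fin t → ℝ)) × (Fin t → ℝ)) × (X → ℝ) → ℝ := fun p =>
    S.indicator (fun _ => (1 : ℝ)) p.1 * ⨆ b, (postMean k σ a' p.1.2 b + p.2 b)
  let u : ((𝒰 × (Fin t → ℝ)) × (Fin t → ℝ)) × ℝ → ℝ := fun p =>
    S.indicator (fun _ => (1 : ℝ)) p.1 * ⨆ b, (postMean k σ a' p.1.2 b + √p.2 * √(v b))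
  have hind : Measurable (S.indicator fun _ => (1 : ℝ)) := measurable_const.indicator hS
  have hgm : Measurable g := (hind.comp measurable_fst).mul (measurable_iSup_of_finite fun b =>
    ((measurable_postMean b).comp (by fun_prop)).add (by fun_prop))
  have hum : Measurable u := (hind.comp measurable_fst).mul (measurable_iSup_of_finite fun b =>
    ((measurable_postMean b).comp (by fun_prop)).add (by fun_prop))
  have hmul : ∀ (q : Ω → ℝ) ω, S.indicator (fun _ => (1 : ℝ)) (W ω) * q ω =
      {ω | ∀ i < t, x i ω = a i}.indicator q ω := by
    intro q ω
    rw [hE]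
    by_cases hω : W ω ∈ S <;> simp [hω]
  have hgW : ∀ ω, g (W ω, fun b => R b ω) =
      {ω | ∀ i < t, x i ω = a i}.indicator (fun ω => ⨆ b, f b ω) ω := by
    intro ω
    rw [← hmul]
    refine congrArg _ (iSup_congr fun b => ?_)
    exact hfm b ω
  have huW : ∀ ω, u (W ω, ζ t ω) = {ω | ∀ i < t, x i ω = a i}.indicator
      (fun ω => ⨆ b, (m b ω + √(ζ t ω) * √(v b))) ω := fun ω => by
    rw [← hmul]
  have hsqi := h.integrable_sqrt_zeta t
  have hfsup : Integrable (fun ω => ⨆ b, f b ω) P := integrable_iSup_of_finite hm.measurable_f hfi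
  have husup : Integrable (fun ω => ⨆ b, (m b ω + √(ζ t ω) * √(v b))) P := by
    refine integrable_iSup_of_finite (fun b => ?_) fun b => (hmi b).add (hsqi.mul_const _)
    exact (hmm b).add ((h.measurable_zeta t).sqrt.mul_const _)
  have hle : ∫ ω, g (W ω, fun b => R b ω) ∂P ≤ ∫ ω, u (W ω, ζ t ω) ∂P := by
    refine integral_le_of_conditional hWm hRvm (h.measurable_zeta t)
      (h.indepFun_residual hm hσ a' t) (h.indepFun_zeta hm a') hgm hum ?_ ?_ fun w => ?_
    · simp_rw [hgW]
      exact hfsup.indicator hEm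
    · simp_rw [huW]
      exact husup.indicator hEm
    · by_cases hw : w ∈ S
      · simp only [g, u, Set.indicator_of_mem hw, one_mul]
        rw [h.map_zeta t]
        have : IsProbabilityMeasure (P.map fun ω b => R b ω) :=
          Measure.isProbabilityMeasure_map hRvm.aemeasurable
        refine integral_iSup_le_integral_ucb hX hs _ (fun b => hm.postVar_nonneg hσ a' b)
          (R := fun b (r : X → ℝ) => r b) (fun b => measurable_pi_apply b) fun b => ?_
        rw [Measure.map_map (measurable_pi_apply b) hRvm]
        exact hm.map_residual hσ a' b
      · simp [g, u, hw]
  simp_rw [hgW, huW] at hle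
  rw [integral_indicator hEm, integral_indicator hEm] at hle
  refine hle.trans_eq ?_
  have hvi : Integrable (fun ω => √(ζ t ω) * √(v (x t ω))) P :=
    integrable_select (g := fun b ω => √(ζ t ω) * √(v b))
      (fun b => (h.measurable_zeta t).sqrt.mul_const _) (fun b => hsqi.mul_const _) (hx t)
  have hfxi : Integrable (fun ω => f (x t ω) ω) P := integrable_select hm.measurable_f hfi (hx t)
  have hRxi : Integrable (fun ω => R (x t ω) ω) P := integrable_select hRm hRi (hx t)
  -- On the path the largest bound is attained at `x t`, and there the posterior mean is `f - R`;
  -- the integral of `R` vanishes.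
  have hucb : ∫ ω in {ω | ∀ i < t, x i ω = a i}, ⨆ b, (m b ω + √(ζ t ω) * √(v b)) ∂P =
      ∫ ω in {ω | ∀ i < t, x i ω = a i},
        ((f (x t ω) ω + √(ζ t ω) * √(v (x t ω))) - R (x t ω) ω) ∂P := by
    refine setIntegral_congr_fun hEm fun ω hω => ?_
    have h1 : (fun i : Fin t => x i ω) = a' := funext fun i => hω i i.2
    have h2 : (fun i : Fin t => obs f ε x i ω) = fixedObs f ε a' ω :=
      funext fun i => by rw [obs, hω i i.2, fixedObs]
    have hmax : ∀ b, m b ω + √(ζ t ω) * √(v b) ≤ m (x t ω) ω + √(ζ t ω) * √(v (x t ω)) := by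
      intro b
      have := h.argmax t ω b
      rw [h1, h2] at this
      exact this
    have hsup : ⨆ b, (m b ω + √(ζ t ω) * √(v b)) = m (x t ω) ω + √(ζ t ω) * √(v (x t ω)) :=
      le_antisymm (ciSup_le hmax)
        (le_iSup_of_finite (fun b => m b ω + √(ζ t ω) * √(v b)) (x t ω))
    simp only [hsup, ← hfm (x t ω) ω]
    ring
  have hsumi : Integrable (fun ω => f (x t ω) ω + √(ζ t ω) * √(v (x t ω))) P := hfxi.add hvi
  rw [hucb, integral_sub hsumi.integrableOn hRxi.integrableOn,
    h.setIntegral_residual hm hσ a t, sub_zero]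

/-- The expected instantaneous regret is at most the expected width of the confidence bound. -/
theorem IsIRGPUCB.integral_regret_le (hm : IsGPModel P k σ f ε)
    (h : IsIRGPUCB P k σ s (1 / 2) f ε ζ U x) (hσ : 0 < σ) (hX : 2 ≤ Fintype.card X)
    (hs : s = 2 * Real.log ((Fintype.card X : ℝ) / 2)) (hk1 : ∀ b, k b b = 1) (t : ℕ) :
    Integrable (fun ω => √(ζ t ω) * √(postVar k σ (fun i : Fin t => x i ω) (x t ω))) P ∧
    ∫ ω, ((⨆ b, f b ω) - f (x t ω) ω) ∂P ≤
      ∫ ω, √(ζ t ω) * √(postVar k σ (fun i : Fin t => x i ω) (x t ω)) ∂P := by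
  have hx := h.measurable_query hm
  have hfi : ∀ b, Integrable (f b) P := fun b => (hm.memLp b).integrable (by norm_num)
  have hpath : Measurable fun ω (i : Fin t) => x i ω := measurable_pi_lambda _ fun i => hx i
  have hvm : Measurable fun ω => √(postVar k σ (fun i : Fin t => x i ω) (x t ω)) :=
    ((Measurable.of_discrete (f := fun p : (Fin t → X) × X => postVar k σ p.1 p.2)).comp
      (hpath.prodMk (hx t))).sqrt
  have hv1 : ∀ ω, √(postVar k σ (fun i : Fin t => x i ω) (x t ω)) ≤ 1 := fun ω => by
    rw [Real.sqrt_le_one]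
    exact (postVar_le hm.posSemidef hσ _ _).trans_eq (hk1 _)
  have hint : Integrable (fun ω => √(ζ t ω) * √(postVar k σ (fun i : Fin t => x i ω) (x t ω))) P :=
    (h.integrable_sqrt_zeta t).mul_bdd (c := 1) hvm.aestronglyMeasurable
      (Filter.Eventually.of_forall fun ω => by
        rw [Real.norm_eq_abs, abs_of_nonneg (Real.sqrt_nonneg _)]
        exact hv1 ω)
  have hfsup : Integrable (fun ω => ⨆ b, f b ω) P := integrable_iSup_of_finite hm.measurable_f hfi
  have hfxi : Integrable (fun ω => f (x t ω) ω) P := integrable_select hm.measurable_f hfi (hx t)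
  have hsumi : Integrable (fun ω => f (x t ω) ω +
      √(ζ t ω) * √(postVar k σ (fun i : Fin t => x i ω) (x t ω))) P := hfxi.add hint
  refine ⟨hint, ?_⟩
  rw [integral_sub hfsup hfxi, sub_le_iff_le_add', ← integral_add hfxi hint,
    integral_eq_sum_fibers hfsup hpath, integral_eq_sum_fibers hsumi hpath]
  refine Finset.sum_le_sum fun c _ => ?_
  -- The values at indices `i ≥ t` are arbitrary; only the first `t` points matter.
  let a : ℕ → X := fun i => if hi : i < t then c ⟨i, hi⟩ else Classical.arbitrary X
  have hac : (fun i : Fin t => a i) = c := funext fun i => by simp [a]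
  have hfib : (fun ω (i : Fin t) => x i ω) ⁻¹' {c} = {ω | ∀ i < t, x i ω = a i} := by
    ext ω
    rw [Set.mem_preimage, Set.mem_singleton_iff, ← hac, funext_iff, Fin.forall_iff]
    rfl
  rw [hfib]
  refine (h.setIntegral_iSup_le hm hσ hX hs a t).trans_eq ?_
  rw [← hfib]
  refine setIntegral_congr_fun (hpath (measurableSet_singleton c)) fun ω hω => ?_
  have hω' : (fun i : Fin t => x i ω) = c := hω
  simp only [hac, hω']

/-- The right side is smallest at `l = √(B / C)`. With the AM-GM step in `IsIRGPUCB.BSR_le` this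
replaces the Cauchy-Schwarz inequality. -/
theorem le_sqrt_of_forall_le {r B C : ℝ} (hB : 0 ≤ B) (hC : 0 < C)
    (h : ∀ l : ℝ, 0 < l → r ≤ (l * C + B / l) / 2) : r ≤ √(C * B) := by
  -- For `B = 0` the optimal `l` would be `0`, which is excluded, so `l` is taken arbitrarily small.
  rcases hB.eq_or_lt with rfl | hB
  · rw [mul_zero, Real.sqrt_zero]
    refine le_of_forall_pos_le_add fun e he => ?_
    have := h (e / C) (by positivity)
    rw [zero_div, div_mul_cancel₀ _ hC.ne'] at this
    linarith
  · have hq : 0 < √(C * B) := Real.sqrt_pos.2 (by positivity)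
    have hsq : √(C * B) * √(C * B) = C * B := Real.mul_self_sqrt (by positivity)
    refine (h (√(C * B) / C) (by positivity)).trans_eq ?_
    rw [div_mul_cancel₀ _ hC.ne']
    have : B / (√(C * B) / C) = √(C * B) := by
      rw [div_div_eq_mul_div, div_eq_iff hq.ne', hsq]
      ring
    rw [this]
    ring

theorem IsIRGPUCB.integrable_simpleRegret (hm : IsGPModel P k σ f ε)
    (h : IsIRGPUCB P k σ s (1 / 2) f ε ζ U x) {T : ℕ} (hT : 0 < T) :
    Integrable (simpleRegret f x T) P := by
  have hx := h.measurable_query hm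
  have hfi : ∀ b, Integrable (f b) P := fun b => (hm.memLp b).integrable (by norm_num)
  have : Nonempty (Fin T) := ⟨⟨0, hT⟩⟩
  exact (integrable_iSup_of_finite hm.measurable_f hfi).sub
    (integrable_iSup_of_finite (fun t : Fin T => measurable_select hm.measurable_f (hx t))
      fun t => integrable_select hm.measurable_f hfi (hx t))

/-- The Bayesian simple regret of IRGP-UCB. -/
theorem IsIRGPUCB.BSR_le (hm : IsGPModel P k σ f ε)
    (h : IsIRGPUCB P k σ s (1 / 2) f ε ζ U x) (hσ : 0 < σ) (hX : 2 ≤ Fintype.card X)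
    (hs : s = 2 * Real.log ((Fintype.card X : ℝ) / 2)) (hk1 : ∀ b, k b b = 1) {T : ℕ}
    (hT : 0 < T) :
    BSR P f x T ≤ √(2 / Real.log (1 + (σ ^ 2)⁻¹) * (2 + s) * (maxInfoGain P f ε T).toReal / T) := by
  have hx := h.measurable_query hm
  have hfi : ∀ b, Integrable (f b) P := fun b => (hm.memLp b).integrable (by norm_num)
  have hs0 : 0 ≤ s := by
    have hX' : (2 : ℝ) ≤ Fintype.card X := by exact_mod_cast hX
    have := Real.log_nonneg (x := (Fintype.card X : ℝ) / 2) (by linarith)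
    rw [hs]
    linarith
  have hC₁ : 0 < 2 / Real.log (1 + (σ ^ 2)⁻¹) := by
    have : 0 < (σ ^ 2)⁻¹ := by positivity
    exact div_pos two_pos (Real.log_pos (by linarith))
  have hT' : (0 : ℝ) < T := by exact_mod_cast hT
  set C₁ := 2 / Real.log (1 + (σ ^ 2)⁻¹) with hC₁def
  set γ := (maxInfoGain P f ε T).toReal with hγ
  have hγ0 : 0 ≤ γ := ENNReal.toReal_nonneg
  let v : ℕ → Ω → ℝ := fun t ω => postVar k σ (fun i : Fin t => x i ω) (x t ω)
  have hv0 : ∀ t ω, 0 ≤ v t ω := fun t ω => hm.postVar_nonneg hσ _ _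
  have hv1 : ∀ t ω, v t ω ≤ 1 := fun t ω => (postVar_le hm.posSemidef hσ _ _).trans_eq (hk1 _)
  have hvm : ∀ t, Measurable (v t) := fun t =>
    (Measurable.of_discrete (f := fun p : (Fin t → X) × X => postVar k σ p.1 p.2)).comp
      ((measurable_pi_lambda _ fun i : Fin t => hx i).prodMk (hx t))
  have hvi : ∀ t, Integrable (v t) P := fun t =>
    Integrable.mono' (integrable_const (1 : ℝ)) (hvm t).aestronglyMeasurable
      (Filter.Eventually.of_forall fun ω => by
        rw [Real.norm_eq_abs, abs_of_nonneg (hv0 t ω)]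
        exact hv1 t ω)
  have hsum : ∑ t ∈ Finset.range T, ∫ ω, v t ω ∂P ≤ C₁ * γ := by
    rw [← integral_finsetSum _ fun t _ => hvi t]
    refine (integral_mono (integrable_finsetSum _ fun t _ => hvi t) (integrable_const (C₁ * γ))
      fun ω => ?_).trans_eq (by simp)
    refine (sum_postVar_le hm.posSemidef hk1 hσ (fun t a b => hm.postVar_nonneg hσ a b)
      (fun t => x t ω) T).trans ?_
    exact mul_le_mul_of_nonneg_left (hm.gaussInfo_le_maxInfoGain hσ _) hC₁.le
  have hSR := h.integrable_simpleRegret hm hT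
  -- One weight `l` serves all rounds and is optimised only after summation.
  have hstep : ∀ l : ℝ, 0 < l → ∀ t < T,
      BSR P f x T ≤ (l * (2 + s) + (∫ ω, v t ω ∂P) / l) / 2 := by
    intro l hl t ht
    obtain ⟨hwi, hreg⟩ := h.integral_regret_le hm hσ hX hs hk1 t
    have h1 : BSR P f x T ≤ ∫ ω, ((⨆ b, f b ω) - f (x t ω) ω) ∂P := by
      refine integral_mono hSR ((integrable_iSup_of_finite hm.measurable_f hfi).sub
        (integrable_select hm.measurable_f hfi (hx t))) fun ω => ?_
      exact sub_le_sub_left (le_iSup_of_finite (fun t : Fin T => f (x t ω) ω) ⟨t, ht⟩) _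
    obtain ⟨hzi, hz⟩ := h.integrable_zeta t
    have hζ : ∀ᵐ ω ∂P, s < ζ t ω := by
      have := ae_lt_twoParamExp s (r := 1 / 2) (by norm_num)
      rw [← h.map_zeta t] at this
      exact ae_of_ae_map (h.measurable_zeta t).aemeasurable this
    have h2 : ∫ ω, √(ζ t ω) * √(v t ω) ∂P ≤ ∫ ω, (l * ζ t ω + v t ω / l) / 2 ∂P := by
      refine integral_mono_ae hwi (((hzi.const_mul l).add ((hvi t).div_const l)).div_const 2) ?_
      filter_upwards [hζ] with ω hω
      have e1 := Real.sq_sqrt (hs0.trans hω.le)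
      have e2 := Real.sq_sqrt (hv0 t ω)
      have e3 : (l * ζ t ω + v t ω / l) / 2 - √(ζ t ω) * √(v t ω) =
          (l * √(ζ t ω) - √(v t ω)) ^ 2 / (2 * l) := by
        rw [← e1, ← e2]
        simp only [Real.sqrt_sq (Real.sqrt_nonneg _)]
        field_simp
        ring
      have e4 : 0 ≤ (l * √(ζ t ω) - √(v t ω)) ^ 2 / (2 * l) := by positivity
      linarith
    rw [integral_div, integral_add (hzi.const_mul l) ((hvi t).div_const l), integral_const_mul, hz,
      integral_div] at h2
    exact h1.trans (hreg.trans h2)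
  have hmain : BSR P f x T ≤ √((2 + s) * (C₁ * γ / T)) := by
    refine le_sqrt_of_forall_le (by positivity) (by linarith) fun l hl => ?_
    have hall := Finset.sum_le_sum fun t (ht : t ∈ Finset.range T) =>
      hstep l hl t (Finset.mem_range.1 ht)
    rw [Finset.sum_const, Finset.card_range, nsmul_eq_mul, ← Finset.sum_div,
      Finset.sum_add_distrib, Finset.sum_const, Finset.card_range, nsmul_eq_mul,
      ← Finset.sum_div] at hall
    have hdiv : (∑ t ∈ Finset.range T, ∫ ω, v t ω ∂P) / l ≤ C₁ * γ / l :=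
      div_le_div_of_nonneg_right hsum hl.le
    have hT2 : T * BSR P f x T ≤ T * ((l * (2 + s) + C₁ * γ / T / l) / 2) := by
      have : T * ((l * (2 + s) + C₁ * γ / T / l) / 2) =
          (T * (l * (2 + s)) + C₁ * γ / l) / 2 := by
        field_simp
      rw [this]
      linarith
    exact le_of_mul_le_mul_left hT2 hT'
  refine hmain.trans_eq ?_
  congr 1
  ring

end Regret

end GPBandit

/-! ### The stopping time and the final bound -/

theorem corollary1 {d : ℕ} (D : Finset (EuclideanSpace ℝ (Fin d))) (hD : D.Nonempty)
    {Ω 𝒰 : Type*} [MeasurableSpace Ω] [MeasurableSpace 𝒰] (P : Measure Ω) [IsProbabilityMeasure P]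
    (k : D → D → ℝ) (hk : GPBandit.IsStationary k) (hk1 : ∀ x, k x x = 1)
    (σ : ℝ) (hσ : 0 < σ)
    (f : D → Ω → ℝ) (ε ζ : ℕ → Ω → ℝ) (U : Ω → 𝒰) (x : ℕ → Ω → D)
    (s : ℝ) (hs : s = 2 * Real.log ((D.card : ℝ) / 2))
    (hmodel : GPBandit.IsGPModel P k σ f ε)
    (halg : GPBandit.IsIRGPUCB P k σ s (1 / 2) f ε ζ U x)
    (C₁ C₂ : ℝ) (hC₁ : C₁ = 2 / Real.log (1 + (σ ^ 2)⁻¹)) (hC₂ : C₂ = 2 + s)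
    (η : ℝ) (hη : 0 < η) :
    ∃ T : ℕ,
      IsLeast {n : ℕ | 0 < n ∧
        √(C₁ * C₂ * (GPBandit.maxInfoGain P f ε n).toReal / n) ≤ η} T ∧
      Integrable (GPBandit.simpleRegret f x T) P ∧
      GPBandit.BSR P f x T ≤ η := by
  have : Nonempty D := hD.to_subtype
  have hlim : Filter.Tendsto
      (fun n : ℕ => √(C₁ * C₂ * (GPBandit.maxInfoGain P f ε n).toReal / n))
      Filter.atTop (nhds 0) := by
    have h := ((hmodel.tendsto_maxInfoGain_div hσ).const_mul (C₁ * C₂)).sqrt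
    rw [mul_zero, Real.sqrt_zero] at h
    simpa only [mul_div_assoc] using h
  have hne : {n : ℕ | 0 < n ∧
      √(C₁ * C₂ * (GPBandit.maxInfoGain P f ε n).toReal / n) ≤ η}.Nonempty :=
    ((Filter.eventually_gt_atTop 0).and (hlim.eventually_le_const hη)).exists
  obtain ⟨hT, hTη⟩ := Nat.sInf_mem hne
  refine ⟨_, ⟨Nat.sInf_mem hne, fun n hn => Nat.sInf_le hn⟩,
    halg.integrable_simpleRegret hmodel hT, ?_⟩
  -- For a single point `s` is negative and the tail comparison is not available, but the regret is
  -- zero.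
  rcases Nat.lt_or_ge (Fintype.card D) 2 with hcard | hcard
  · have : Subsingleton D := Fintype.card_le_one_iff_subsingleton.1 (by omega)
    have hzero : ∀ T : ℕ, 0 < T → GPBandit.BSR P f x T = 0 := by
      intro T hT
      have : Nonempty (Fin T) := ⟨⟨0, hT⟩⟩
      have : GPBandit.simpleRegret f x T = fun _ => 0 := by
        ext ω
        obtain ⟨b⟩ := ‹Nonempty D›
        have hb : ∀ b', f b' ω = f b ω := fun b' => by rw [Subsingleton.elim b' b]
        simp [GPBandit.simpleRegret, hb]
      simp [GPBandit.BSR, this]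
    rw [hzero _ hT]
    exact hη.le
  · refine (halg.BSR_le hmodel hσ hcard (by rw [hs, Fintype.card_coe]) hk1 hT).trans ?_
    rw [← hC₁, ← hC₂]
    exact hTη
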